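/- Let $k$ be a field and let $H$ be a Hopf $k$-algebra with invertible antipode $\gamma$, comultiplication $\Delta$, such that every nonzero element of $H$ acts by a nonzero operator on some finite-dimensional $H$-module (equivalently, the pairing of $H$ with its finite dual $H^\circ$ is nondegenerate). Let $R=\sum_i R_i'\otimes R_i''\in H\otimes H$ be an invertible element with $(\Delta\otimes 1)R=R^{13}R^{23}$, $(1\otimes\Delta)R=R^{13}R^{12}$ and $\Delta^{\mathrm{op}}(a)=R\,\Delta(a)R^{-1}$ for all $a\in H$, and let $\kappa\in H$ be a grouplike element with $\kappa^2=u_1u_4$ and $\kappa a\kappa^{-1}=\gamma^2(a)$ for all $a\in H$, where $u_1=\sum_i\gamma(R_i'')R_i'$ and $u_4=\sum_i\gamma^2(R_i')R_i''$; that is, $(H,R,\kappa)$ is a ribbon Hopf algebra. Put $\nu=u_4\kappa^{-1}$; this ribbon element is the ribbon twist of the category $H$-mod of finite-dimensional $H$-modules, whose braiding is $c(x\otimes y)=\sum_i R_i''y\otimes R_i'x$. For $L\in H$-mod let $L^\vee$ be the dual space $L^*$ with $(h.\xi)(x)=\xi(\gamma^{-1}(h)x)$. Let $F=\int^{L}L\otimes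 L^\vee$ be the coend, i.e. the cokernel of $$\bigoplus_{f:A\to B}A\otimes B^\vee\xrightarrow{\,f\otimes B^\vee-A\otimes f^t\,}\bigoplus_{L}L\otimes L^\vee ,$$ where $f$ runs over all morphisms and $L$ over all objects of $H$-mod. Let $\omega:F\otimes F\to k$ be the pairing induced by the maps $$(\mathrm{ev}\otimes\mathrm{ev})\circ(1\otimes c^2\otimes 1):L\otimes L^\vee\otimes M\otimes M^\vee\to k ,$$ where $c^2$ is the double braiding of $L^\vee$ and $M$, let $\operatorname{Ann}\omega\subset F$ be its (left) annihilator, and let $\underline{\nu\otimes 1}:F\to F$ be the map induced by the maps $\nu\otimes 1: L\otimes L^\vee\to L\otimes L^\vee$. The algebra $(H,R,\kappa)$ is called $2$-modular if $H$-mod satisfies the two axioms (M1) there is an exact sequence of $H$-modules $0\to\operatorname{Ann}\omega\to F\to\mathbf f\to 0$ with $\mathbf f$ finite dimensional; (M2) $\underline{\nu\otimes 1}(\operatorname{Ann}\omega)\subset\operatorname{Ann}\omega$. Let $\mathbf u\subset H$ be the linear span of the elements $$l_V^-(v\otimes w)=\sum_{i,j}\langle v,R_j''R_i'.w\rangle\,R_j'R_i'',\qquad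 V\in H\text{-mod},\ v\in V,\ w\in V^\vee .$$ **Theorem.** The element $\nu$ is invertible, and the following are equivalent: (i) $(H,R,\kappa)$ is $2$-modular; (ii) $\nu\in\mathbf u$; (iii) $\nu^{-1}\in\mathbf u$. -/

import Mathlib

open scoped TensorProduct DirectSum

universe u v w w'

noncomputable section

namespace RibbonHopf

section HopfPreliminaries

variable (k : Type u) (H : Type v) [Field k] [Ring H] [HopfAlgebra k H]

/-- `R₁₂ = R ⊗ 1` inside `H ⊗ H ⊗ H`. -/
def leg12 : H ⊗[k] H →ₐ[k] (H ⊗[k] H) ⊗[k] H :=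
  Algebra.TensorProduct.includeLeft

/-- `R₁₃`, given by `x ⊗ y ↦ (x ⊗ 1) ⊗ y`. -/
def leg13 : H ⊗[k] H →ₐ[k] (H ⊗[k] H) ⊗[k] H :=
  Algebra.TensorProduct.map Algebra.TensorProduct.includeLeft (AlgHom.id k H)

/-- `R₂₃ = 1 ⊗ R`, given by `x ⊗ y ↦ (1 ⊗ x) ⊗ y`. -/
def leg23 : H ⊗[k] H →ₐ[k] (H ⊗[k] H) ⊗[k] H :=
  Algebra.TensorProduct.map Algebra.TensorProduct.includeRight (AlgHom.id k H)

/-- The map `Δ ⊗ 1`. -/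
def comulLeft : H ⊗[k] H →ₗ[k] (H ⊗[k] H) ⊗[k] H :=
  TensorProduct.map Coalgebra.comul LinearMap.id

/-- The map `1 ⊗ Δ`, rebracketed to the left. -/
def comulRight : H ⊗[k] H →ₗ[k] (H ⊗[k] H) ⊗[k] H :=
  (TensorProduct.assoc k H H H).symm.toLinearMap ∘ₗ
    TensorProduct.map LinearMap.id Coalgebra.comul

/-- The element `u₁ = γ(R'') R'` attached to `R = R' ⊗ R''`. -/
def elementU1 (R : H ⊗[k] H) : H :=
  LinearMap.mul' k H
    (TensorProduct.map (HopfAlgebra.antipode k) LinearMap.id (TensorProduct.comm k H H R))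

/-- The element `u₄ = γ²(R') R''` attached to `R = R' ⊗ R''`. -/
def elementU4 (R : H ⊗[k] H) : H :=
  LinearMap.mul' k H
    (TensorProduct.map (HopfAlgebra.antipode k ∘ₗ HopfAlgebra.antipode k) LinearMap.id R)

/-- A quasitriangular structure on a Hopf algebra with invertible antipode. -/
structure QuasitriangularStructure where
  /-- The antipode is invertible. -/
  antipode_bijective : Function.Bijective (HopfAlgebra.antipode k : H →ₗ[k] H)
  /-- The universal `R`-matrix, an invertible element of the algebraic tensor product. -/
  R : (H ⊗[k] H)ˣ
  /-- `(Δ ⊗ 1) R = R₁₃ R₂₃`. -/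
  comul_left : comulLeft k H (R : H ⊗[k] H) = leg13 k H R * leg23 k H R
  /-- `(1 ⊗ Δ) R = R₁₃ R₁₂`. -/
  comul_right : comulRight k H (R : H ⊗[k] H) = leg13 k H R * leg12 k H R
  /-- `Δᵒᵖ(a) = R Δ(a) R⁻¹`. -/
  comul_op : ∀ a : H, TensorProduct.comm k H H (Coalgebra.comul a) =
    (R : H ⊗[k] H) * Coalgebra.comul a * ((R⁻¹ : (H ⊗[k] H)ˣ) : H ⊗[k] H)

/-- A ribbon structure `(R, κ)` on a Hopf algebra: a quasitriangular structure together with a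
grouplike element `κ` such that `κ² = g := u₁ u₄` and `κ a κ⁻¹ = γ²(a)`. -/
structure RibbonStructure extends QuasitriangularStructure k H where
  /-- The grouplike element (grouplike elements are automatically invertible). -/
  κ : Hˣ
  isGroupLike : IsGroupLikeElem k (κ : H)
  sq_eq : (κ : H) ^ 2 = elementU1 k H R * elementU4 k H R
  conj_eq : ∀ a : H, (κ : H) * a * ((κ⁻¹ : Hˣ) : H) =
    HopfAlgebra.antipode k (HopfAlgebra.antipode k a)

end HopfPreliminaries

section Modules

variable (k : Type u) (H : Type v) [Field k] [Ring H] [HopfAlgebra k H]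

/-- An object of `H`-mod: a finite dimensional `k`-vector space with an action of `H`. -/
structure FDMod where
  carrier : Type u
  [addCommGroup : AddCommGroup carrier]
  [module : Module k carrier]
  [finite : Module.Finite k carrier]
  /-- The action of `H`. -/
  ρ : H →ₐ[k] Module.End k carrier

attribute [instance] FDMod.addCommGroup FDMod.module FDMod.finite

variable {k H}

/-- `f` intertwines two actions of `H`, that is, it is a morphism of `H`-modules. -/
def IsHom {V : Type w} {W : Type w'} [AddCommGroup V] [Module k V] [AddCommGroup W] [Module k W]
    (ρ : H →ₐ[k] Module.End k V) (σ : H →ₐ[k] Module.End k W) (f : V →ₗ[k] W) : Prop :=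
  ∀ (h : H) (x : V), f (ρ h x) = σ h (f x)

variable (k H) in
/-- `H` has enough finite dimensional modules: only `0 ∈ H` acts by zero on all of them.
Equivalently, the pairing of `H` with its finite dual is nondegenerate. -/
def HasEnoughFDModules : Prop :=
  ∀ h : H, (∀ V : FDMod k H, V.ρ h = 0) → h = 0

/-- The action of an element of `H ⊗ H` on `V ⊗ W`. -/
def actTwo {V : Type w} {W : Type w'} [AddCommGroup V] [Module k V] [AddCommGroup W]
    [Module k W] (ρ : H →ₐ[k] Module.End k V) (σ : H →ₐ[k] Module.End k W) :
    H ⊗[k] H →ₐ[k] Module.End k (V ⊗[k] W) :=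
  (Module.endTensorEndAlgHom (R := k) (S := k) (A := k)).comp (Algebra.TensorProduct.map ρ σ)

theorem actTwo_tmul {V : Type w} {W : Type w'} [AddCommGroup V] [Module k V] [AddCommGroup W]
    [Module k W] (ρ : H →ₐ[k] Module.End k V) (σ : H →ₐ[k] Module.End k W) (a b : H)
    (x : V) (y : W) : actTwo ρ σ (a ⊗ₜ b) (x ⊗ₜ y) = ρ a x ⊗ₜ σ b y := by
  simp only [actTwo, AlgHom.comp_apply, Algebra.TensorProduct.map_tmul]
  rfl

/-- The tensor product action, `h ↦ (ρ ⊗ σ)(Δ h)`. -/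
def tensorAction {V : Type w} {W : Type w'} [AddCommGroup V] [Module k V] [AddCommGroup W]
    [Module k W] (ρ : H →ₐ[k] Module.End k V) (σ : H →ₐ[k] Module.End k W) :
    H →ₐ[k] Module.End k (V ⊗[k] W) :=
  (actTwo ρ σ).comp (Bialgebra.comulAlgHom k H)

/-- The evaluation `V ⊗ V* → k`, `v ⊗ ξ ↦ ξ(v)`. -/
def ev (V : Type w) [AddCommGroup V] [Module k V] : V ⊗[k] Module.Dual k V →ₗ[k] k :=
  TensorProduct.lift (Module.Dual.eval k V)

end Modules

namespace QuasitriangularStructure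

variable {k : Type u} {H : Type v} [Field k] [Ring H] [HopfAlgebra k H]
variable (Q : QuasitriangularStructure k H)

/-- The inverse of the antipode. -/
def antipodeInv : H ≃ₗ[k] H :=
  (LinearEquiv.ofBijective (HopfAlgebra.antipode k) Q.antipode_bijective).symm

theorem antipode_antipodeInv (a : H) : HopfAlgebra.antipode k (Q.antipodeInv a) = a :=
  LinearEquiv.apply_symm_apply
    (LinearEquiv.ofBijective (HopfAlgebra.antipode k) Q.antipode_bijective) a

theorem antipodeInv_one : Q.antipodeInv (1 : H) = 1 := by
  apply Q.antipode_bijective.1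
  rw [antipode_antipodeInv, HopfAlgebra.antipode_one]

theorem antipodeInv_mul (a b : H) :
    Q.antipodeInv (a * b) = Q.antipodeInv b * Q.antipodeInv a := by
  apply Q.antipode_bijective.1
  rw [antipode_antipodeInv, HopfAlgebra.antipode_mul_antidistrib, antipode_antipodeInv,
    antipode_antipodeInv]

/-- The action of `H` on the right dual `V^∨`: the space `V*` of linear functionals with
`(h.ξ)(x) = ξ(γ⁻¹(h).x)`. -/
def dualAction {V : Type w} [AddCommGroup V] [Module k V] (ρ : H →ₐ[k] Module.End k V) :
    H →ₐ[k] Module.End k (Module.Dual k V) :=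
  AlgHom.ofLinearMap
    (Module.Dual.transpose (R := k) ∘ₗ ρ.toLinearMap ∘ₗ Q.antipodeInv.toLinearMap)
    (by
      ext ξ x
      simp [antipodeInv_one, Module.Dual.transpose_apply])
    (by
      intro a b
      ext ξ x
      simp [antipodeInv_mul, Module.Dual.transpose_apply])

theorem dualAction_apply {V : Type w} [AddCommGroup V] [Module k V]
    (ρ : H →ₐ[k] Module.End k V) (h : H) (ξ : Module.Dual k V) (x : V) :
    Q.dualAction ρ h ξ x = ξ (ρ (Q.antipodeInv h) x) := rfl

/-- The braiding `c : V ⊗ W → W ⊗ V`, `v ⊗ w ↦ R''.w ⊗ R'.v`. -/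
def braiding {V : Type w} {W : Type w'} [AddCommGroup V] [Module k V] [AddCommGroup W]
    [Module k W] (ρ : H →ₐ[k] Module.End k V) (σ : H →ₐ[k] Module.End k W) :
    V ⊗[k] W →ₗ[k] W ⊗[k] V :=
  (TensorProduct.comm k V W).toLinearMap ∘ₗ actTwo ρ σ (Q.R : H ⊗[k] H)

/-- The double braiding `c² : V ⊗ W → W ⊗ V → V ⊗ W`. -/
def doubleBraiding {V : Type w} {W : Type w'} [AddCommGroup V] [Module k V] [AddCommGroup W]
    [Module k W] (ρ : H →ₐ[k] Module.End k V) (σ : H →ₐ[k] Module.End k W) :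
    V ⊗[k] W →ₗ[k] V ⊗[k] W :=
  Q.braiding σ ρ ∘ₗ Q.braiding ρ σ

/-- The element `R²¹ R¹² = ∑ R_j'' R_i' ⊗ R_j' R_i''` of `H ⊗ H`. -/
def monodromyElement : H ⊗[k] H :=
  TensorProduct.comm k H H (Q.R : H ⊗[k] H) * (Q.R : H ⊗[k] H)

/-- The element `l⁻_V(v ⊗ w) = ∑ ⟨v, R_j'' R_i'.w⟩ R_j' R_i''` of `H`,
for `v ∈ V` and `w ∈ V^∨`. -/
def lMinus (V : FDMod k H) (v : V.carrier) (w : Module.Dual k V.carrier) : H :=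
  TensorProduct.lid k H
    (TensorProduct.map
      (Module.Dual.eval k V.carrier v ∘ₗ
        LinearMap.applyₗ w ∘ₗ (Q.dualAction V.ρ).toLinearMap)
      LinearMap.id Q.monodromyElement)

/-- The subspace `u ⊆ H` spanned by all `l⁻_V(v ⊗ w)`. -/
def subspaceU : Submodule k H :=
  Submodule.span k {x : H | ∃ (V : FDMod k H) (v : V.carrier) (w : Module.Dual k V.carrier),
    x = Q.lMinus V v w}

theorem doubleBraiding_tmul {V : Type w} {W : Type w'} [AddCommGroup V] [Module k V]
    [AddCommGroup W] [Module k W] (ρ : H →ₐ[k] Module.End k V) (σ : H →ₐ[k] Module.End k W)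
    (x : V ⊗[k] W) : Q.doubleBraiding ρ σ x = actTwo ρ σ Q.monodromyElement x := by
  have key : ∀ (t : H ⊗[k] H) (y : V ⊗[k] W),
      TensorProduct.comm k W V (actTwo σ ρ t (TensorProduct.comm k V W y)) =
        actTwo ρ σ (TensorProduct.comm k H H t) y := by
    intro t y
    induction t with
    | zero => simp
    | add s t hs ht => simp only [map_add, LinearMap.add_apply, hs, ht]
    | tmul a b =>
      induction y with
      | zero => simp
      | add y z hy hz => simp only [map_add, hy, hz]
      | tmul v w => simp [actTwo_tmul]
  simp only [doubleBraiding, braiding, LinearMap.comp_apply, monodromyElement, map_mul,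
    LinearEquiv.coe_coe, Module.End.mul_apply]
  exact key _ _

/-- The element `l⁻_V(v ⊗ w)` acts on every `H`-module `X` as the operator
`x ↦ (ev ⊗ 1)(1 ⊗ c²)(v ⊗ w ⊗ x)`. -/
theorem lMinus_apply (V : FDMod k H) (v : V.carrier) (w : Module.Dual k V.carrier)
    {X : Type w} [AddCommGroup X] [Module k X] (σ : H →ₐ[k] Module.End k X) (x : X) :
    σ (Q.lMinus V v w) x =
      TensorProduct.lid k X
        (TensorProduct.map (ev V.carrier) LinearMap.id
          ((TensorProduct.assoc k V.carrier (Module.Dual k V.carrier) X).symm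
            (v ⊗ₜ Q.doubleBraiding (Q.dualAction V.ρ) σ (w ⊗ₜ x)))) := by
  rw [doubleBraiding_tmul, lMinus]
  generalize Q.monodromyElement = t
  induction t with
  | zero => simp
  | add s t hs ht =>
    simp only [map_add, LinearMap.add_apply, TensorProduct.tmul_add, hs, ht]
  | tmul a b => simp [actTwo_tmul, ev]

end QuasitriangularStructure

section Coend

variable (k : Type u) (H : Type v) [Field k] [Ring H] [HopfAlgebra k H]

open scoped Classical in
/-- The subspace of `⨁_L L ⊗ L^∨` that is the image of `⨁_{f : A → B} A ⊗ B^∨` under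
`f ⊗ B^∨ - A ⊗ fᵗ`, where `f` runs over all morphisms of `H`-mod. -/
def coendRelations : Submodule k (⨁ L : FDMod k H, L.carrier ⊗[k] Module.Dual k L.carrier) :=
  Submodule.span k {x | ∃ (A B : FDMod k H) (f : A.carrier →ₗ[k] B.carrier)
    (_ : IsHom A.ρ B.ρ f) (a : A.carrier) (ξ : Module.Dual k B.carrier),
    x = DirectSum.lof k (FDMod k H) (fun L => L.carrier ⊗[k] Module.Dual k L.carrier) B
          (f a ⊗ₜ ξ) -
        DirectSum.lof k (FDMod k H) (fun L => L.carrier ⊗[k] Module.Dual k L.carrier) A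
          (a ⊗ₜ Module.Dual.transpose (R := k) f ξ)}

/-- The coend `F = ∫^L L ⊗ L^∨`, the cokernel of
`⨁_{f : A → B} A ⊗ B^∨ → ⨁_L L ⊗ L^∨`. -/
abbrev CoendF : Type _ :=
  (⨁ L : FDMod k H, L.carrier ⊗[k] Module.Dual k L.carrier) ⧸ coendRelations k H

variable {k H}

open scoped Classical in
/-- The canonical map `i_L : L ⊗ L^∨ → F`. -/
def coendMap (L : FDMod k H) : L.carrier ⊗[k] Module.Dual k L.carrier →ₗ[k] CoendF k H :=
  (coendRelations k H).mkQ ∘ₗ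
    DirectSum.lof k (FDMod k H) (fun L => L.carrier ⊗[k] Module.Dual k L.carrier) L

theorem coendMap_rel {A B : FDMod k H} {f : A.carrier →ₗ[k] B.carrier} (hf : IsHom A.ρ B.ρ f)
    (a : A.carrier) (ξ : Module.Dual k B.carrier) :
    coendMap B (f a ⊗ₜ ξ) = coendMap A (a ⊗ₜ Module.Dual.transpose (R := k) f ξ) := by
  classical
  refine (Submodule.Quotient.eq _).2 (Submodule.subset_span ⟨A, B, f, hf, a, ξ, ?_⟩)
  congr!

open scoped Classical in
/-- A dinatural family `L ⊗ L^∨ → E` factors through the coend. -/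
def coendLift {E : Type w} [AddCommGroup E] [Module k E]
    (φ : ∀ L : FDMod k H, L.carrier ⊗[k] Module.Dual k L.carrier →ₗ[k] E)
    (hφ : ∀ (A B : FDMod k H) (f : A.carrier →ₗ[k] B.carrier), IsHom A.ρ B.ρ f →
      ∀ (a : A.carrier) (ξ : Module.Dual k B.carrier),
        φ B (f a ⊗ₜ ξ) = φ A (a ⊗ₜ Module.Dual.transpose (R := k) f ξ)) :
    CoendF k H →ₗ[k] E :=
  (coendRelations k H).liftQ (DirectSum.toModule k (FDMod k H) E φ) (by
    rw [coendRelations, Submodule.span_le]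
    rintro _ ⟨A, B, f, hf, a, ξ, rfl⟩
    simp only [SetLike.mem_coe, LinearMap.mem_ker, map_sub, DirectSum.toModule_lof]
    rw [hφ A B f hf a ξ, sub_self])

theorem coendLift_coendMap {E : Type w} [AddCommGroup E] [Module k E]
    (φ : ∀ L : FDMod k H, L.carrier ⊗[k] Module.Dual k L.carrier →ₗ[k] E)
    (hφ : ∀ (A B : FDMod k H) (f : A.carrier →ₗ[k] B.carrier), IsHom A.ρ B.ρ f →
      ∀ (a : A.carrier) (ξ : Module.Dual k B.carrier),
        φ B (f a ⊗ₜ ξ) = φ A (a ⊗ₜ Module.Dual.transpose (R := k) f ξ))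
    (L : FDMod k H) (x : L.carrier ⊗[k] Module.Dual k L.carrier) :
    coendLift φ hφ (coendMap L x) = φ L x := by
  classical
  simp [coendLift, coendMap, DirectSum.toModule_lof]

/-- Linear maps out of the coend agree if they agree on all `L ⊗ L^∨`. -/
theorem coend_hom_ext {E : Type w} [AddCommGroup E] [Module k E] {φ ψ : CoendF k H →ₗ[k] E}
    (h : ∀ (L : FDMod k H) (l : L.carrier) (ξ : Module.Dual k L.carrier),
      φ (coendMap L (l ⊗ₜ ξ)) = ψ (coendMap L (l ⊗ₜ ξ))) : φ = ψ := by
  classical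
  refine Submodule.linearMap_qext _ (DirectSum.linearMap_ext k fun L => ?_)
  exact TensorProduct.ext' fun l ξ => h L l ξ

end Coend

namespace QuasitriangularStructure

variable {k : Type u} {H : Type v} [Field k] [Ring H] [HopfAlgebra k H]
variable (Q : QuasitriangularStructure k H)

/-- The action of `H` on the object `L ⊗ L^∨`. -/
def pairAction (L : FDMod k H) :
    H →ₐ[k] Module.End k (L.carrier ⊗[k] Module.Dual k L.carrier) :=
  tensorAction L.ρ (Q.dualAction L.ρ)

theorem transpose_isHom {A B : FDMod k H} {f : A.carrier →ₗ[k] B.carrier}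
    (hf : IsHom A.ρ B.ρ f) :
    IsHom (Q.dualAction B.ρ) (Q.dualAction A.ρ) (Module.Dual.transpose (R := k) f) := by
  intro h ξ
  ext x
  simp [dualAction_apply, Module.Dual.transpose_apply, hf _ _]

theorem coendAction_aux (h : H) (A B : FDMod k H) (f : A.carrier →ₗ[k] B.carrier)
    (hf : IsHom A.ρ B.ρ f) (a : A.carrier) (ξ : Module.Dual k B.carrier) :
    (coendMap B ∘ₗ Q.pairAction B h) (f a ⊗ₜ ξ) =
      (coendMap A ∘ₗ Q.pairAction A h) (a ⊗ₜ Module.Dual.transpose (R := k) f ξ) := by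
  simp only [LinearMap.comp_apply, pairAction, tensorAction, AlgHom.comp_apply]
  generalize Bialgebra.comulAlgHom k H h = t
  induction t with
  | zero => simp
  | add s t hs ht => simp only [map_add, LinearMap.add_apply, hs, ht]
  | tmul x y =>
    rw [actTwo_tmul, actTwo_tmul, ← hf, coendMap_rel hf, Q.transpose_isHom hf]

/-- The `H`-module structure on `F` for which all `i_L : L ⊗ L^∨ → F` are `H`-linear. -/
def coendAction : H →ₐ[k] Module.End k (CoendF k H) :=
  AlgHom.ofLinearMap
    { toFun := fun h => coendLift (fun L => coendMap L ∘ₗ Q.pairAction L h) (Q.coendAction_aux h)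
      map_add' := fun a b => coend_hom_ext fun L l ξ => by
        simp [coendLift_coendMap]
      map_smul' := fun c a => coend_hom_ext fun L l ξ => by
        simp [coendLift_coendMap] }
    (coend_hom_ext fun L l ξ => by simp [coendLift_coendMap])
    (fun a b => coend_hom_ext fun L l ξ => by simp [coendLift_coendMap])

theorem coendMap_isHom (L : FDMod k H) : IsHom (Q.pairAction L) Q.coendAction (coendMap L) := by
  intro h x
  exact (coendLift_coendMap _ (Q.coendAction_aux h) L x).symm

/-- The pairing `(L ⊗ L^∨) ⊗ (M ⊗ M^∨) → k` given by `(ev ⊗ ev)(1 ⊗ c² ⊗ 1)`, with `c²` the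
double braiding of `L^∨` and `M`. -/
def omegaPair (L M : FDMod k H) :
    (L.carrier ⊗[k] Module.Dual k L.carrier) ⊗[k] (M.carrier ⊗[k] Module.Dual k M.carrier)
      →ₗ[k] k :=
  LinearMap.mul' k k ∘ₗ
    TensorProduct.map (ev L.carrier) (ev M.carrier) ∘ₗ
    (TensorProduct.tensorTensorTensorAssoc k L.carrier (Module.Dual k L.carrier) M.carrier
      (Module.Dual k M.carrier)).symm.toLinearMap ∘ₗ
    TensorProduct.map
      (TensorProduct.map LinearMap.id (Q.doubleBraiding (Q.dualAction L.ρ) M.ρ))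
      LinearMap.id ∘ₗ
    (TensorProduct.tensorTensorTensorAssoc k L.carrier (Module.Dual k L.carrier) M.carrier
      (Module.Dual k M.carrier)).toLinearMap

theorem omegaPair_apply (L M : FDMod k H) (l : L.carrier) (ξ : Module.Dual k L.carrier)
    (m : M.carrier) (η : Module.Dual k M.carrier) :
    Q.omegaPair L M ((l ⊗ₜ ξ) ⊗ₜ (m ⊗ₜ η)) = η (M.ρ (Q.lMinus L l ξ) m) := by
  simp only [omegaPair, LinearMap.comp_apply, LinearEquiv.coe_coe,
    TensorProduct.tensorTensorTensorAssoc_tmul, TensorProduct.map_tmul, LinearMap.id_apply,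
    doubleBraiding_tmul, lMinus]
  generalize Q.monodromyElement = t
  induction t with
  | zero => simp
  | add s t hs ht =>
    simp only [map_add, LinearMap.add_apply, TensorProduct.tmul_add, TensorProduct.add_tmul,
      hs, ht]
  | tmul a b => simp [actTwo_tmul, ev]

theorem lMinus_rel {A B : FDMod k H} {f : A.carrier →ₗ[k] B.carrier} (hf : IsHom A.ρ B.ρ f)
    (a : A.carrier) (ξ : Module.Dual k B.carrier) :
    Q.lMinus B (f a) ξ = Q.lMinus A a (Module.Dual.transpose (R := k) f ξ) := by
  simp only [lMinus]
  congr 3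
  ext h
  simp [dualAction_apply, Module.Dual.transpose_apply, hf _ _]

theorem omega_aux_right (L A B : FDMod k H) (x : L.carrier ⊗[k] Module.Dual k L.carrier)
    (f : A.carrier →ₗ[k] B.carrier) (hf : IsHom A.ρ B.ρ f) (a : A.carrier)
    (ξ : Module.Dual k B.carrier) :
    TensorProduct.curry (Q.omegaPair L B) x (f a ⊗ₜ ξ) =
      TensorProduct.curry (Q.omegaPair L A) x
        (a ⊗ₜ Module.Dual.transpose (R := k) f ξ) := by
  induction x with
  | zero => simp
  | add x y hx hy => simp only [map_add, LinearMap.add_apply, hx, hy]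
  | tmul l η =>
    simp [TensorProduct.curry_apply, omegaPair_apply, Module.Dual.transpose_apply, hf _ _]

/-- For fixed `L`, the map `L ⊗ L^∨ → F*` induced by the pairings with all `M ⊗ M^∨`. -/
def omegaLeft (L : FDMod k H) :
    L.carrier ⊗[k] Module.Dual k L.carrier →ₗ[k] (CoendF k H →ₗ[k] k) where
  toFun x := coendLift (fun M => TensorProduct.curry (Q.omegaPair L M) x)
    (fun A B f hf a ξ => Q.omega_aux_right L A B x f hf a ξ)
  map_add' x y := coend_hom_ext fun M m η => by simp [coendLift_coendMap]
  map_smul' c x := coend_hom_ext fun M m η => by simp [coendLift_coendMap]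

/-- The pairing `ω : F ⊗ F → k`, whose composition with `i_L ⊗ i_M` is
`(ev ⊗ ev)(1 ⊗ c² ⊗ 1)`. -/
def omega : CoendF k H →ₗ[k] CoendF k H →ₗ[k] k :=
  coendLift Q.omegaLeft fun A B f hf a ξ => coend_hom_ext fun M m η => by
    simp [omegaLeft, coendLift_coendMap, omegaPair_apply, Q.lMinus_rel hf]

theorem omega_coendMap (L M : FDMod k H) (x : L.carrier ⊗[k] Module.Dual k L.carrier)
    (y : M.carrier ⊗[k] Module.Dual k M.carrier) :
    Q.omega (coendMap L x) (coendMap M y) = Q.omegaPair L M (x ⊗ₜ y) := by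
  simp [omega, omegaLeft, coendLift_coendMap]

/-- The annihilator `Ann ω ⊆ F` of the pairing `ω` (the left one). -/
def annOmega : Submodule k (CoendF k H) := LinearMap.ker Q.omega

/-- Axiom (M1): `f = F / Ann ω` is an object of `H`-mod, that is, there is an exact sequence
`0 → Ann ω → F → f → 0` of `H`-modules with `f` finite dimensional. -/
def AxiomM1 : Prop :=
  ∃ (V : FDMod k H) (π : CoendF k H →ₗ[k] V.carrier),
    IsHom Q.coendAction V.ρ π ∧ Function.Surjective π ∧ LinearMap.ker π = Q.annOmega

end QuasitriangularStructure

namespace RibbonStructure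

variable {k : Type u} {H : Type v} [Field k] [Ring H] [HopfAlgebra k H]
variable (S : RibbonStructure k H)

/-- The ribbon element `ν = γ²(R') R'' κ⁻¹`. -/
def ν : H := elementU4 k H S.R * ((S.κ⁻¹ : Hˣ) : H)

/-- The endomorphism `∫ ν ⊗ 1` of `F`, with `i_L(l ⊗ ξ) ↦ i_L(ν.l ⊗ ξ)`. -/
def twistF : CoendF k H →ₗ[k] CoendF k H :=
  coendLift (fun L => coendMap L ∘ₗ TensorProduct.map (L.ρ S.ν) LinearMap.id)
    (fun A B f hf a ξ => by
      simp only [LinearMap.comp_apply, TensorProduct.map_tmul, LinearMap.id_apply]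
      rw [← hf, coendMap_rel hf])

/-- Axiom (M2): the endomorphism `∫ ν ⊗ 1` of `F` maps `Ann ω` into itself. -/
def AxiomM2 : Prop :=
  ∀ x ∈ S.annOmega, S.twistF x ∈ S.annOmega

/-- `(H, R, κ)` is 2-modular: the ribbon category `H`-mod satisfies (M1) and (M2). -/
def IsTwoModular : Prop := S.AxiomM1 ∧ S.AxiomM2

end RibbonStructure

end RibbonHopf

end

/-!
Write `R = ∑ R' ⊗ R''`, `M = R₂₁ R`, and `(f ⊗ 1)(t) ∈ H` for the slice of `t ∈ H ⊗ H` by a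
functional `f`. Matrix coefficients give a map from the coend `F` onto the finite dual `H°`, and
`ω` becomes the pairing of `H°` with slices of `M`; the slices `(f ⊗ 1)(M)`, `f ∈ H°`, are exactly
the elements of `u` (`subspaceU_eq_map`). Since `(γ ⊗ γ) M = M₂₁`, both sides of `ω` lead to the
same `u`: `Ann ω` is the kernel of a map of `F` onto `u` (`ker_coendSlice`), and it is also the set
of `x ∈ F` that pair to zero with `u` (`mem_annOmega_iff`). It is an `H`-submodule because `M`
commutes with coproducts. As `H°` separates the points of `H`, (M1) means that `u` is finite
dimensional, and (M2) then means that `ν u ⊆ u` (`isTwoModular_iff`).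

The ribbon element satisfies `ν = ∑ R'' κ R'` (`ν_eq`), is central and invertible, and
`Δ(ν) = (ν ⊗ ν) M` (`comul_ν`), by the Yang–Baxter equation.

If `u` is finite dimensional and `ν u ⊆ u`, then `ν u = u`, and `1 ∈ u` gives `ν, ν⁻¹ ∈ u`.
Conversely, the hexagon axioms show that for `z ∈ u` the slices of `Δ(z)` lie in a finite
dimensional subspace `W ⊆ u` (`exists_finite_slice_comul`). For `z = ν`, the identity
`M = (ν⁻¹ ⊗ ν⁻¹) Δ(ν)` gives `u ⊆ ν⁻¹ W`, so that `u` is finite dimensional and `ν u ⊆ u`. For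
`z = ν⁻¹` the same argument applies to `M⁻¹ = (ν ⊗ ν) Δ(ν⁻¹)`, once `u` is known to consist of
slices of `M⁻¹` (`exists_slice_monodromyInv`); this is the Yang–Baxter equation again, contracted
around `κ`.
-/

noncomputable section

namespace RibbonHopf

open Coalgebra HopfAlgebra WithConv

/-! ### Moving the antipode across a convolution identity -/

section Convolution

variable {k : Type u} {H : Type v} [Field k] [Ring H] [HopfAlgebra k H]
  {A : Type w} [Ring A] [Algebra k A]

theorem comp_antipode_convMul (i : H →ₐ[k] A) :
    toConv (i.toLinearMap ∘ₗ antipode k) * toConv i.toLinearMap = 1 := by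
  have h := LinearMap.algHom_comp_convMul_distrib i (toConv (antipode k (A := H)))
    (toConv LinearMap.id)
  rw [LinearMap.antipode_mul_id] at h
  apply WithConv.ofConv_injective
  refine h.symm.trans ?_
  ext x
  simp

theorem convMul_comp_antipode (i : H →ₐ[k] A) :
    toConv i.toLinearMap * toConv (i.toLinearMap ∘ₗ antipode k) = 1 := by
  have h := LinearMap.algHom_comp_convMul_distrib i (toConv LinearMap.id)
    (toConv (antipode k (A := H)))
  rw [LinearMap.id_mul_antipode] at h
  apply WithConv.ofConv_injective
  refine h.symm.trans ?_
  ext x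
  simp

/-- If `∑ P(h₁) j(h₂) = ∑ i(h₁) Q(h₂)` with `i`, `j` algebra maps, then
`∑ i(γ(h₁)) P(h₂) = ∑ Q(h₁) j(γ(h₂))`. -/
theorem convMul_antipode_shift (i j : H →ₐ[k] A) (P Q : H →ₗ[k] A)
    (h : toConv P * toConv j.toLinearMap = toConv i.toLinearMap * toConv Q) :
    toConv (i.toLinearMap ∘ₗ antipode k) * toConv P =
      toConv Q * toConv (j.toLinearMap ∘ₗ antipode k) := by
  calc _ = toConv (i.toLinearMap ∘ₗ antipode k) * (toConv P * toConv j.toLinearMap) *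
        toConv (j.toLinearMap ∘ₗ antipode k) := by
        rw [mul_assoc, mul_assoc, convMul_comp_antipode, mul_one]
    _ = _ := by rw [h, ← mul_assoc, comp_antipode_convMul, one_mul]

/-- An element invariant under the adjoint action `h ▹ w = ∑ γ(h₁) w h₂` is central. -/
theorem commute_of_adjoint_invariant (z : H)
    (hz : ∀ h : H, ∑ i ∈ (ℛ k h).index,
      antipode k ((ℛ k h).left i) * (z * (ℛ k h).right i) = counit (R := k) h • z)
    (h : H) : Commute z h := by
  have h1 : toConv (antipode k (A := H)) * toConv (LinearMap.mulLeft k z) =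
      toConv (LinearMap.mulLeft k z ∘ₗ Algebra.linearMap k H ∘ₗ counit) := by
    ext h
    rw [(ℛ k h).convMul_apply]
    simpa [Algebra.smul_def, Algebra.commutes] using hz h
  have h2 := congrArg (fun f => toConv LinearMap.id * f) h1
  simp only [← mul_assoc, LinearMap.id_mul_antipode, one_mul] at h2
  have h3 := congrArg (fun f => f.ofConv h) h2
  simp only [(ℛ k h).convMul_apply] at h3
  have h4 : ∑ i ∈ (ℛ k h).index, counit (R := k) ((ℛ k h).right i) • (ℛ k h).left i = h := by
    have h5 := congrArg (TensorProduct.rid k H) (sum_tmul_counit_eq (ℛ k h))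
    simpa only [map_sum, TensorProduct.rid_tmul, one_smul] using h5
  simp only [LinearMap.mulLeft_apply, LinearMap.comp_apply, LinearMap.id_apply,
    Algebra.linearMap_apply] at h3
  rw [Commute, SemiconjBy]
  refine h3.trans ?_
  conv_rhs => rw [← h4]
  rw [Finset.sum_mul]
  refine Finset.sum_congr rfl fun i _ => ?_
  rw [← Algebra.commutes, ← Algebra.smul_def]
  simp

end Convolution

/-! ### Quasitriangular identities -/

namespace QuasitriangularStructure

variable {k : Type u} {H : Type v} [Field k] [Ring H] [HopfAlgebra k H]
variable (Q : QuasitriangularStructure k H)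

theorem antipodeInv_antipode (a : H) : Q.antipodeInv (antipode k a) = a :=
  LinearEquiv.symm_apply_apply
    (LinearEquiv.ofBijective (antipode k) Q.antipode_bijective) a

/-- `∑ γ⁻¹(a₂) a₁ = ε(a)`. -/
theorem sum_antipodeInv_mul {ι : Type*} {a : H} (r : Coalgebra.Repr k a ι) :
    ∑ i ∈ r.index, Q.antipodeInv (r.right i) * r.left i = counit (R := k) a • (1 : H) := by
  apply Q.antipode_bijective.1
  simp only [map_sum, antipode_mul_antidistrib, Q.antipode_antipodeInv, map_smul, antipode_one]
  exact sum_antipode_mul_eq_smul r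

section Expansion

variable {n : ℕ} {x y : Fin n → H} (hR : (Q.R : H ⊗[k] H) = ∑ i, x i ⊗ₜ[k] y i)

include hR

/-- `(Δ ⊗ 1) R = R₁₃ R₂₃` in coordinates. -/
theorem comul_left_sum : ∑ i, comul (R := k) (x i) ⊗ₜ[k] y i =
    ∑ a, ∑ b, (x a ⊗ₜ[k] x b) ⊗ₜ[k] (y a * y b) := by
  have h := Q.comul_left
  rw [hR] at h
  simpa [comulLeft, leg13, leg23, Finset.sum_mul_sum] using h

/-- `(1 ⊗ Δ) R = R₁₃ R₁₂` in coordinates. -/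
theorem comul_right_sum : ∑ i, x i ⊗ₜ[k] comul (R := k) (y i) =
    ∑ a, ∑ b, (x a * x b) ⊗ₜ[k] (y b ⊗ₜ[k] y a) := by
  have h := congrArg (TensorProduct.assoc k H H H) Q.comul_right
  rw [hR] at h
  simpa [comulRight, leg13, leg12, Finset.sum_mul_sum] using h

end Expansion

/-- The Yang–Baxter equation `R₁₂ R₁₃ R₂₃ = R₂₃ R₁₃ R₁₂`. -/
theorem yang_baxter : leg12 k H Q.R * leg13 k H Q.R * leg23 k H Q.R =
    leg23 k H Q.R * leg13 k H Q.R * leg12 k H Q.R := by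
  -- `R₁₂ (Δ ⊗ 1)(t) = (Δᵒᵖ ⊗ 1)(t) R₁₂`, to be used for `t = R`.
  have key : ∀ t : H ⊗[k] H, leg12 k H Q.R * comulLeft k H t =
      TensorProduct.map (TensorProduct.comm k H H).toLinearMap LinearMap.id (comulLeft k H t) *
        leg12 k H Q.R := by
    intro t
    induction t with
    | zero => simp
    | add s t hs ht => simp only [map_add, mul_add, add_mul, hs, ht]
    | tmul a b =>
      simp [comulLeft, leg12, Q.comul_op, mul_assoc]
  have hswap : ∀ s t : H ⊗[k] H,
      TensorProduct.map (TensorProduct.comm k H H).toLinearMap LinearMap.id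
        (leg13 k H s * leg23 k H t) = leg23 k H s * leg13 k H t := by
    intro s t
    induction s with
    | zero => simp
    | add s s' hs hs' => simp only [map_add, add_mul, hs, hs']
    | tmul a b =>
      induction t with
      | zero => simp
      | add t t' ht ht' => simp only [map_add, mul_add, ht, ht']
      | tmul c d => simp [leg13, leg23]
  have h := key Q.R
  rw [Q.comul_left, hswap] at h
  rw [mul_assoc, h]

/-- `(ε ⊗ 1) R = 1`. -/
theorem counit_left : TensorProduct.lid k H
    (TensorProduct.map (counit (R := k)) LinearMap.id (Q.R : H ⊗[k] H)) = 1 := by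
  obtain ⟨n, x, y, hR⟩ := TensorProduct.exists_sum_tmul_eq (Q.R : H ⊗[k] H)
  have h := congrArg (TensorProduct.map ((TensorProduct.lid k H).toLinearMap ∘ₗ
    TensorProduct.map (counit (R := k)) LinearMap.id) LinearMap.id) (Q.comul_left_sum hR)
  have hx : ∀ a : H, TensorProduct.lid k H (TensorProduct.map (counit (R := k)) LinearMap.id
      (comul (R := k) a)) = a := by
    intro a
    simpa [LinearMap.rTensor] using
      congrArg (TensorProduct.lid k H) (rTensor_counit_comul (R := k) a)
  simp only [map_sum, TensorProduct.map_tmul, LinearMap.comp_apply, LinearEquiv.coe_coe, hx,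
    LinearMap.id_apply, TensorProduct.lid_tmul] at h
  -- Applying `ε` to the first leg of `(Δ ⊗ 1) R = R₁₃ R₂₃` gives `R = (1 ⊗ e) R`.
  have h1 : (Q.R : H ⊗[k] H) =
      (1 ⊗ₜ[k] ∑ a, counit (R := k) (x a) • y a) * (Q.R : H ⊗[k] H) := by
    conv_lhs => rw [hR, h]
    rw [hR]
    simp [TensorProduct.tmul_sum, Finset.sum_mul_sum, TensorProduct.smul_tmul']
  have h2 : (1 : H ⊗[k] H) = 1 ⊗ₜ[k] ∑ a, counit (R := k) (x a) • y a := by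
    have := congrArg (· * ((Q.R⁻¹ : (H ⊗[k] H)ˣ) : H ⊗[k] H)) h1
    simpa [mul_assoc] using this
  have h3 := congrArg (fun t => TensorProduct.lid k H
    (TensorProduct.map (counit (R := k)) LinearMap.id t)) h2
  rw [hR]
  simpa [Algebra.TensorProduct.one_def] using h3.symm

/-- `(1 ⊗ ε) R = 1`. -/
theorem counit_right : TensorProduct.rid k H
    (TensorProduct.map LinearMap.id (counit (R := k)) (Q.R : H ⊗[k] H)) = 1 := by
  obtain ⟨n, x, y, hR⟩ := TensorProduct.exists_sum_tmul_eq (Q.R : H ⊗[k] H)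
  have h := congrArg (TensorProduct.map LinearMap.id ((TensorProduct.rid k H).toLinearMap ∘ₗ
    TensorProduct.map LinearMap.id (counit (R := k)))) (Q.comul_right_sum hR)
  have hx : ∀ a : H, TensorProduct.rid k H (TensorProduct.map LinearMap.id (counit (R := k))
      (comul (R := k) a)) = a := by
    intro a
    simpa [LinearMap.lTensor] using
      congrArg (TensorProduct.rid k H) (lTensor_counit_comul (R := k) a)
  simp only [map_sum, TensorProduct.map_tmul, LinearMap.comp_apply, LinearEquiv.coe_coe, hx,
    LinearMap.id_apply, TensorProduct.rid_tmul] at h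
  have h1 : (Q.R : H ⊗[k] H) =
      ((∑ a, counit (R := k) (y a) • x a) ⊗ₜ[k] 1) * (Q.R : H ⊗[k] H) := by
    conv_lhs => rw [hR, h]
    rw [hR]
    simp [TensorProduct.sum_tmul, Finset.sum_mul_sum, TensorProduct.smul_tmul']
  have h2 : (1 : H ⊗[k] H) = (∑ a, counit (R := k) (y a) • x a) ⊗ₜ[k] 1 := by
    have := congrArg (· * ((Q.R⁻¹ : (H ⊗[k] H)ˣ) : H ⊗[k] H)) h1
    simpa [mul_assoc] using this
  have h3 := congrArg (fun t => TensorProduct.rid k H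
    (TensorProduct.map LinearMap.id (counit (R := k)) t)) h2
  rw [hR]
  simpa [Algebra.TensorProduct.one_def] using h3.symm

/-- `R⁻¹ = (γ ⊗ 1) R`. -/
theorem antipode_left : TensorProduct.map (antipode k) LinearMap.id (Q.R : H ⊗[k] H) =
    ((Q.R⁻¹ : (H ⊗[k] H)ˣ) : H ⊗[k] H) := by
  obtain ⟨n, x, y, hR⟩ := TensorProduct.exists_sum_tmul_eq (Q.R : H ⊗[k] H)
  have h := congrArg (TensorProduct.map (LinearMap.mul' k H ∘ₗ
    TensorProduct.map (antipode k) LinearMap.id) LinearMap.id) (Q.comul_left_sum hR)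
  have hx : ∀ a : H, LinearMap.mul' k H (TensorProduct.map (antipode k) LinearMap.id
      (comul (R := k) a)) = counit (R := k) a • (1 : H) := by
    intro a
    rw [← Algebra.algebraMap_eq_smul_one]
    exact mul_antipode_rTensor_comul_apply a
  have hc := Q.counit_left
  rw [hR] at hc
  simp only [map_sum, TensorProduct.map_tmul, LinearMap.comp_apply, hx,
    LinearMap.id_apply, TensorProduct.lid_tmul, LinearMap.mul'_apply] at h hc
  refine left_inv_eq_right_inv (a := (Q.R : H ⊗[k] H)) ?_ (Units.mul_inv _)
  rw [hR]
  simp only [map_sum, TensorProduct.map_tmul, LinearMap.id_apply, Finset.sum_mul_sum,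
    Algebra.TensorProduct.tmul_mul_tmul]
  rw [← h]
  simp only [TensorProduct.smul_tmul, ← TensorProduct.tmul_sum, hc]
  rfl

/-- `R⁻¹ = (1 ⊗ γ⁻¹) R`. -/
theorem antipodeInv_right :
    TensorProduct.map LinearMap.id Q.antipodeInv.toLinearMap (Q.R : H ⊗[k] H) =
      ((Q.R⁻¹ : (H ⊗[k] H)ˣ) : H ⊗[k] H) := by
  obtain ⟨n, x, y, hR⟩ := TensorProduct.exists_sum_tmul_eq (Q.R : H ⊗[k] H)
  have h := congrArg (TensorProduct.map LinearMap.id (LinearMap.mul' k H ∘ₗ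
    TensorProduct.map Q.antipodeInv.toLinearMap LinearMap.id ∘ₗ
      (TensorProduct.comm k H H).toLinearMap)) (Q.comul_right_sum hR)
  have hx : ∀ a : H, LinearMap.mul' k H (TensorProduct.map Q.antipodeInv.toLinearMap LinearMap.id
      (TensorProduct.comm k H H (comul (R := k) a))) = counit (R := k) a • (1 : H) := by
    intro a
    rw [← Q.sum_antipodeInv_mul (ℛ k a)]
    conv_lhs => rw [← (ℛ k a).eq]
    simp
  have hc := Q.counit_right
  rw [hR] at hc
  simp only [map_sum, TensorProduct.map_tmul, LinearMap.comp_apply, hx, LinearEquiv.coe_coe,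
    LinearMap.id_apply, TensorProduct.rid_tmul, LinearMap.mul'_apply,
    TensorProduct.comm_tmul] at h hc
  refine left_inv_eq_right_inv (a := (Q.R : H ⊗[k] H)) ?_ (Units.mul_inv _)
  rw [hR]
  simp only [map_sum, TensorProduct.map_tmul, LinearMap.id_apply, Finset.sum_mul_sum,
    Algebra.TensorProduct.tmul_mul_tmul, LinearEquiv.coe_coe]
  rw [← h]
  simp only [← TensorProduct.smul_tmul, ← TensorProduct.sum_tmul, hc]
  rfl

/-- `(γ ⊗ γ) R = R`. -/
theorem antipode_antipode : TensorProduct.map (antipode k) (antipode k) (Q.R : H ⊗[k] H) =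
    (Q.R : H ⊗[k] H) := by
  have h := congrArg (TensorProduct.map LinearMap.id (antipode k))
    (Q.antipode_left.trans Q.antipodeInv_right.symm)
  simp only [← LinearMap.comp_apply, ← TensorProduct.map_comp, LinearMap.id_comp,
    LinearMap.comp_id] at h
  rw [h]
  convert LinearMap.id_apply (R := k) (Q.R : H ⊗[k] H)
  rw [← TensorProduct.map_id]
  congr 1
  ext a
  exact Q.antipode_antipodeInv a

/-- The monodromy element commutes with coproducts. -/
theorem commute_monodromyElement (h : H) :
    Commute Q.monodromyElement (comul (R := k) h) := by
  have h1 := congrArg (· * (Q.R : H ⊗[k] H)) (Q.comul_op h)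
  simp only [mul_assoc, Units.inv_mul, mul_one] at h1
  have hc : ∀ s t : H ⊗[k] H, TensorProduct.comm k H H (s * t) =
      TensorProduct.comm k H H s * TensorProduct.comm k H H t :=
    fun s t => map_mul (Algebra.TensorProduct.comm k H H) s t
  have h2 := congrArg (TensorProduct.comm k H H) h1
  simp only [hc] at h2
  have h3 : TensorProduct.comm k H H (TensorProduct.comm k H H (comul (R := k) h)) =
      comul (R := k) h := TensorProduct.comm_comm _ _ _ _
  rw [h3] at h2
  rw [Commute, SemiconjBy, monodromyElement, mul_assoc, ← h1, ← mul_assoc, ← h2, mul_assoc]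

/-- `(γ ⊗ γ) (R₂₁ R) = R R₂₁`. -/
theorem antipode_monodromyElement :
    TensorProduct.map (antipode k) (antipode k) Q.monodromyElement =
      TensorProduct.comm k H H Q.monodromyElement := by
  have hmul : ∀ s t : H ⊗[k] H, TensorProduct.map (antipode k) (antipode k) (s * t) =
      TensorProduct.map (antipode k) (antipode k) t *
        TensorProduct.map (antipode k) (antipode k) s := by
    intro s t
    induction s with
    | zero => simp
    | add s s' hs hs' => simp only [map_add, add_mul, mul_add, hs, hs']
    | tmul a b =>
      induction t with
      | zero => simp
      | add t t' ht ht' => simp only [map_add, mul_add, add_mul, ht, ht']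
      | tmul c d => simp [antipode_mul_antidistrib]
  have hc : ∀ s t : H ⊗[k] H, TensorProduct.comm k H H (s * t) =
      TensorProduct.comm k H H s * TensorProduct.comm k H H t :=
    fun s t => map_mul (Algebra.TensorProduct.comm k H H) s t
  have hmc : ∀ t : H ⊗[k] H, TensorProduct.map (antipode k) (antipode k)
      (TensorProduct.comm k H H t) =
      TensorProduct.comm k H H (TensorProduct.map (antipode k) (antipode k) t) :=
    fun t => TensorProduct.map_comm _ _ _
  rw [monodromyElement, hmul, hmc, Q.antipode_antipode, hc]
  congr 1
  exact (TensorProduct.comm_comm _ _ _ _).symm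

end QuasitriangularStructure

/-! ### The ribbon element and its coproduct -/

section Contract

variable {k : Type u} {H : Type v} [Field k] [Ring H] [HopfAlgebra k H]

variable (k) in
/-- The contraction `a ⊗ b ↦ b z a`. -/
def contract (z : H) :
    H ⊗[k] H →ₗ[k] H :=
  LinearMap.mul' k H ∘ₗ TensorProduct.map (LinearMap.mulRight k z) LinearMap.id ∘ₗ
    (TensorProduct.comm k H H).toLinearMap

@[simp]
theorem contract_tmul (z a b : H) : contract k z (a ⊗ₜ b) = b * z * a := by
  simp [contract]

theorem comm_mul (s t : H ⊗[k] H) : TensorProduct.comm k H H (s * t) =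
    TensorProduct.comm k H H s * TensorProduct.comm k H H t :=
  map_mul (Algebra.TensorProduct.comm k H H) s t

end Contract

namespace QuasitriangularStructure

variable {k : Type u} {H : Type v} [Field k] [Ring H] [HopfAlgebra k H]
variable (Q : QuasitriangularStructure k H)

/-- If `γ²(h) = z h z⁻¹`, then contracting the `R`-matrix around `z` gives a central element. -/
theorem commute_contract (z : Hˣ)
    (hz : ∀ a : H, (z : H) * a * ((z⁻¹ : Hˣ) : H) = antipode k (antipode k a)) (h : H) :
    Commute (contract k (z : H) (Q.R : H ⊗[k] H)) h := by
  -- The shifted form of `R Δ(h) = Δᵒᵖ(h) R`, contracted around `z`, is adjoint invariance.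
  refine commute_of_adjoint_invariant (k := k) _ (fun h => ?_) h
  have hzinv : ∀ a : H, antipode k a * (z : H) = (z : H) * Q.antipodeInv a := by
    intro a
    have := hz (Q.antipodeInv a)
    rw [Q.antipode_antipodeInv] at this
    rw [← this, mul_assoc, Units.inv_mul, mul_one]
  have key := convMul_antipode_shift (k := k) (H := H) (A := H ⊗[k] H)
    Algebra.TensorProduct.includeRight Algebra.TensorProduct.includeRight
    (LinearMap.mulLeft k (Q.R : H ⊗[k] H) ∘ₗ
      (Algebra.TensorProduct.includeLeft : H →ₐ[k] H ⊗[k] H).toLinearMap)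
    (LinearMap.mulRight k (Q.R : H ⊗[k] H) ∘ₗ
      (Algebra.TensorProduct.includeLeft : H →ₐ[k] H ⊗[k] H).toLinearMap) (by
      ext a
      have h1 := congrArg (· * (Q.R : H ⊗[k] H)) (Q.comul_op a)
      simp only [mul_assoc, Units.inv_mul, mul_one] at h1
      simp only [(ℛ k a).convMul_apply]
      rw [← (ℛ k a).eq] at h1
      simpa [Finset.sum_mul, Finset.mul_sum, mul_assoc, ← mul_assoc _ _ (Q.R : H ⊗[k] H)]
        using h1.symm)
  have key2 := congrArg (fun f => contract k (z : H) (f.ofConv h)) key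
  simp only [(ℛ k h).convMul_apply] at key2
  obtain ⟨n, x, y, hR⟩ := TensorProduct.exists_sum_tmul_eq (Q.R : H ⊗[k] H)
  simp only [hR, map_sum, LinearMap.comp_apply, AlgHom.toLinearMap_apply,
    Algebra.TensorProduct.includeLeft_apply, Algebra.TensorProduct.includeRight_apply,
    LinearMap.mulLeft_apply, LinearMap.mulRight_apply, Finset.mul_sum, Finset.sum_mul,
    Algebra.TensorProduct.tmul_mul_tmul, mul_one, one_mul, contract_tmul] at key2 ⊢
  have hl : ∀ i ∈ (ℛ k h).index, ∑ j, antipode k ((ℛ k h).left i) *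
      (y j * (z : H) * x j * (ℛ k h).right i) =
      ∑ j, antipode k ((ℛ k h).left i) * y j * (z : H) * (x j * (ℛ k h).right i) := by
    intro i _
    simp only [mul_assoc]
  rw [Finset.sum_congr rfl hl, key2, Finset.sum_comm, Finset.smul_sum]
  refine Finset.sum_congr rfl fun j _ => ?_
  have hs := Q.sum_antipodeInv_mul (ℛ k h)
  have hs2 := congrArg (fun a => y j * (z : H) * a * x j) hs
  simp only [Finset.mul_sum, Finset.sum_mul] at hs2
  simp only [mul_smul_comm, smul_mul_assoc, mul_one] at hs2
  rw [← hs2]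
  refine Finset.sum_congr rfl fun i _ => ?_
  rw [mul_assoc (y j), hzinv]
  simp only [mul_assoc]

/-- The inverse `R⁻¹ (R⁻¹)₂₁` of the monodromy element. -/
def monodromyInv : H ⊗[k] H :=
  ((Q.R⁻¹ : (H ⊗[k] H)ˣ) : H ⊗[k] H) *
    TensorProduct.comm k H H ((Q.R⁻¹ : (H ⊗[k] H)ˣ) : H ⊗[k] H)

theorem monodromyInv_mul : Q.monodromyInv * Q.monodromyElement = 1 := by
  rw [monodromyInv, monodromyElement, mul_assoc, ← mul_assoc (TensorProduct.comm k H H _),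
    ← comm_mul, Units.inv_mul, Algebra.TensorProduct.one_def, TensorProduct.comm_tmul,
    ← Algebra.TensorProduct.one_def, one_mul, Units.inv_mul]

section Expansion

variable {n : ℕ} {x y : Fin n → H} (hR : (Q.R : H ⊗[k] H) = ∑ i, x i ⊗ₜ[k] y i)

include hR

theorem monodromyElement_sum :
    Q.monodromyElement = ∑ b, ∑ a, (y b * x a) ⊗ₜ[k] (x b * y a) := by
  simp [monodromyElement, hR, Finset.sum_mul_sum]

/-- The Yang–Baxter equation with its outer legs contracted around an element `z` for which the
contraction of the `R`-matrix is central. -/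
theorem yang_baxter_contract (z : H) (hz : ∀ h : H, Commute (contract k z (Q.R : H ⊗[k] H)) h) :
    ∑ c, ∑ b, ∑ a, (y b * y c * z * (x a * x b)) ⊗ₜ[k] (y a * x c) =
      (contract k z (Q.R : H ⊗[k] H) ⊗ₜ[k] 1) * Q.monodromyElement := by
  have h := Q.yang_baxter
  rw [hR] at h
  simp only [leg12, leg13, leg23, map_sum, Algebra.TensorProduct.includeLeft_apply,
    Algebra.TensorProduct.map_tmul, Algebra.TensorProduct.includeRight_apply, AlgHom.id_apply,
    Finset.mul_sum, Finset.sum_mul, Algebra.TensorProduct.tmul_mul_tmul, mul_one,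
    one_mul] at h
  -- `f` is the contraction `(p ⊗ m) ⊗ q ↦ q z p ⊗ m`.
  let f : (H ⊗[k] H) ⊗[k] H →ₗ[k] H ⊗[k] H := TensorProduct.lift
    (LinearMap.mk₂ k (fun t q => ((q * z) ⊗ₜ[k] (1 : H)) * t)
      (fun _ _ _ => by rw [mul_add]) (fun _ _ _ => by rw [mul_smul_comm])
      (fun _ _ _ => by rw [add_mul, TensorProduct.add_tmul, add_mul])
      (fun _ _ _ => by rw [smul_mul_assoc, ← TensorProduct.smul_tmul', smul_mul_assoc]))
  have h' := congrArg f h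
  simp only [f, map_sum, TensorProduct.lift.tmul, LinearMap.mk₂_apply,
    Algebra.TensorProduct.tmul_mul_tmul, one_mul] at h'
  rw [h', Q.monodromyElement_sum hR]
  simp only [Finset.mul_sum]
  conv_rhs => rw [Finset.sum_comm]
  refine Finset.sum_congr rfl fun a _ => ?_
  rw [Finset.sum_comm]
  refine Finset.sum_congr rfl fun c _ => ?_
  rw [Algebra.TensorProduct.tmul_mul_tmul, one_mul, ← mul_assoc, (hz (y c)).eq, hR, map_sum,
    Finset.mul_sum, Finset.sum_mul, TensorProduct.sum_tmul]
  refine Finset.sum_congr rfl fun b _ => ?_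
  simp only [contract_tmul, mul_assoc]

end Expansion

end QuasitriangularStructure

namespace RibbonStructure

variable {k : Type u} {H : Type v} [Field k] [Ring H] [HopfAlgebra k H]
variable (S : RibbonStructure k H)

/-- `∑ R'' κ R'` is inverse to `∑ R'' κ⁻¹ γ(R')`. -/
theorem contract_mul_contract : contract k (S.κ : H) (S.R : H ⊗[k] H) *
    contract k ((S.κ⁻¹ : Hˣ) : H) ((S.R⁻¹ : (H ⊗[k] H)ˣ) : H ⊗[k] H) = 1 := by
  have hc := S.commute_contract S.κ S.conj_eq
  obtain ⟨n, x, y, hR⟩ := TensorProduct.exists_sum_tmul_eq (S.R : H ⊗[k] H)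
  have h1 : (S.R : H ⊗[k] H) * ((S.R⁻¹ : (H ⊗[k] H)ˣ) : H ⊗[k] H) = 1 := Units.mul_inv _
  have hinv := S.antipode_left
  rw [hR] at hinv
  simp only [map_sum, TensorProduct.map_tmul, LinearMap.id_apply] at hinv
  rw [← hinv]
  rw [← hinv, hR] at h1
  have h2 := congrArg (LinearMap.mul' k H ∘ₗ (TensorProduct.comm k H H).toLinearMap ∘ₗ
    TensorProduct.map (antipode k) LinearMap.id) h1
  simp only [Finset.sum_mul_sum, map_sum, Algebra.TensorProduct.tmul_mul_tmul,
    LinearMap.comp_apply, TensorProduct.map_tmul, LinearEquiv.coe_coe, TensorProduct.comm_tmul,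
    LinearMap.mul'_apply, LinearMap.id_apply, antipode_mul_antidistrib,
    Algebra.TensorProduct.one_def, antipode_one, mul_one] at h2
  rw [← h2, map_sum, Finset.mul_sum]
  refine Finset.sum_congr rfl fun i _ => ?_
  rw [contract_tmul, mul_assoc, ← mul_assoc, (hc (y i)).eq, hR, map_sum, Finset.mul_sum,
    Finset.sum_mul]
  refine Finset.sum_congr rfl fun j _ => ?_
  rw [contract_tmul, ← S.conj_eq]
  simp only [mul_assoc]

theorem contract_mul_contract' :
    contract k ((S.κ⁻¹ : Hˣ) : H) ((S.R⁻¹ : (H ⊗[k] H)ˣ) : H ⊗[k] H) *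
      contract k (S.κ : H) (S.R : H ⊗[k] H) = 1 := by
  rw [← (S.commute_contract S.κ S.conj_eq _).eq, S.contract_mul_contract]

/-- `u₁ = κ · ∑ R'' κ⁻¹ γ(R')`. -/
theorem elementU1_eq : elementU1 k H S.R =
    (S.κ : H) * contract k ((S.κ⁻¹ : Hˣ) : H) ((S.R⁻¹ : (H ⊗[k] H)ˣ) : H ⊗[k] H) := by
  obtain ⟨n, x, y, hR⟩ := TensorProduct.exists_sum_tmul_eq (S.R : H ⊗[k] H)
  rw [elementU1, ← S.antipode_left]
  conv_lhs => rw [← S.antipode_antipode]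
  simp only [hR, map_sum, TensorProduct.map_tmul, TensorProduct.comm_tmul, LinearMap.mul'_apply,
    LinearMap.id_apply, contract_tmul, Finset.mul_sum, ← S.conj_eq, mul_assoc]

/-- The ribbon element `γ²(R') R'' κ⁻¹` equals `R'' κ R'`. This rests on `κ² = u₁ u₄`. -/
theorem ν_eq : S.ν = contract k (S.κ : H) (S.R : H ⊗[k] H) := by
  have h := S.sq_eq
  rw [S.elementU1_eq, pow_two, mul_assoc] at h
  have h2 := (Units.mul_right_inj S.κ).1 h
  have h3 : elementU4 k H S.R = contract k (S.κ : H) (S.R : H ⊗[k] H) * S.κ := by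
    conv_rhs => enter [2]; rw [h2]
    rw [← mul_assoc, S.contract_mul_contract, one_mul]
  rw [ν, h3, mul_assoc, Units.mul_inv, mul_one]

theorem commute_ν (h : H) : Commute S.ν h := by
  rw [ν_eq]
  exact S.commute_contract S.κ S.conj_eq h

theorem isUnit_ν : IsUnit S.ν := by
  rw [ν_eq]
  exact ⟨⟨_, _, S.contract_mul_contract, S.contract_mul_contract'⟩, rfl⟩

/-- The twist identity `Δ(ν) = (ν ⊗ ν) R₂₁ R`. -/
theorem comul_ν : comul (R := k) S.ν = (S.ν ⊗ₜ[k] S.ν) * S.monodromyElement := by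
  obtain ⟨n, x, y, hR⟩ := TensorProduct.exists_sum_tmul_eq (S.R : H ⊗[k] H)
  have hν : S.ν = ∑ i, y i * (S.κ : H) * x i := by simp [ν_eq, hR]
  have hYB := S.yang_baxter_contract hR (S.κ : H) (S.commute_contract S.κ S.conj_eq)
  rw [← ν_eq] at hYB
  -- `Δ(ν) = ∑ Δ(R'') (κ ⊗ κ) Δ(R')`. Both coproducts are expanded one leg at a time: `G` reads off
  -- `Δ(R')`, and then `G'`, `G''` read off the two copies of `Δ(R'')`. The inner contraction that
  -- appears in the second tensor factor is `ν` itself.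
  let G : (H ⊗[k] H) ⊗[k] H →ₗ[k] H ⊗[k] H := TensorProduct.lift
    (LinearMap.mk₂ k (fun t q => comul (R := k) q * (((S.κ : H) ⊗ₜ[k] (S.κ : H)) * t))
      (fun _ _ _ => by rw [mul_add, mul_add]) (fun _ _ _ => by rw [mul_smul_comm, mul_smul_comm])
      (fun _ _ _ => by rw [map_add, add_mul])
      (fun _ _ _ => by rw [map_smul, smul_mul_assoc]))
  let G' : H → H → H ⊗[k] (H ⊗[k] H) →ₗ[k] H ⊗[k] H := fun c d => TensorProduct.lift
    (LinearMap.mk₂ k (fun p t => t * (c ⊗ₜ[k] (d * p)))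
      (fun _ _ _ => by rw [mul_add, TensorProduct.tmul_add, mul_add])
      (fun _ _ _ => by rw [mul_smul_comm, TensorProduct.tmul_smul, mul_smul_comm])
      (fun _ _ _ => by rw [add_mul]) (fun _ _ _ => by rw [smul_mul_assoc]))
  let G'' : H → H → H ⊗[k] (H ⊗[k] H) →ₗ[k] H ⊗[k] H := fun c d => TensorProduct.lift
    (LinearMap.mk₂ k (fun p t => t * ((c * p) ⊗ₜ[k] d))
      (fun _ _ _ => by rw [mul_add, TensorProduct.add_tmul, mul_add])
      (fun _ _ _ => by rw [mul_smul_comm, ← TensorProduct.smul_tmul', mul_smul_comm])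
      (fun _ _ _ => by rw [add_mul]) (fun _ _ _ => by rw [smul_mul_assoc]))
  have h1 := congrArg G (S.comul_left_sum hR)
  have h2 := fun c d => congrArg (G' c d) (S.comul_right_sum hR)
  have h3 := fun c d => congrArg (G'' c d) (S.comul_right_sum hR)
  simp only [G, G', G'', map_sum, TensorProduct.lift.tmul, LinearMap.mk₂_apply,
    Algebra.TensorProduct.tmul_mul_tmul, Bialgebra.comul_mul] at h1 h2 h3
  have hL : comul (R := k) S.ν =
      ∑ i, comul (R := k) (y i) * (((S.κ : H) ⊗ₜ[k] (S.κ : H)) * comul (R := k) (x i)) := by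
    rw [hν, map_sum]
    simp only [Bialgebra.comul_mul, S.isGroupLike.comul_eq_tmul_self, mul_assoc]
  have h4 : ∀ a, ∑ b, comul (R := k) (y b) * (((S.κ : H) * x a) ⊗ₜ[k] ((S.κ : H) * x b)) =
      ∑ q, (y q * (S.κ : H) * x a) ⊗ₜ[k] (S.ν * x q) := by
    intro a
    rw [h2, Finset.sum_comm]
    refine Finset.sum_congr rfl fun q _ => ?_
    rw [hν, Finset.sum_mul, TensorProduct.tmul_sum]
    simp only [mul_assoc]
  have h5 : ∀ q, ∑ a, comul (R := k) (y a) * ((y q * (S.κ : H) * x a) ⊗ₜ[k] (S.ν * x q)) =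
      (1 ⊗ₜ[k] S.ν) *
        ∑ b, ∑ a, (y b * y q * (S.κ : H) * (x a * x b)) ⊗ₜ[k] (y a * x q) := by
    intro q
    rw [h3, Finset.sum_comm]
    simp only [Finset.mul_sum, Algebra.TensorProduct.tmul_mul_tmul, one_mul]
    refine Finset.sum_congr rfl fun b _ => Finset.sum_congr rfl fun a _ => ?_
    rw [← mul_assoc (y a), ← (S.commute_ν (y a)).eq]
    simp only [mul_assoc]
  rw [hL, h1]
  simp only [mul_assoc (comul (R := k) _), ← Finset.mul_sum, h4]
  simp only [Finset.mul_sum]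
  rw [Finset.sum_comm]
  simp only [h5]
  rw [← Finset.mul_sum, hYB, ← mul_assoc, Algebra.TensorProduct.tmul_mul_tmul, one_mul, mul_one]

/-- The inverse of the ribbon element. -/
def νInv : H := Ring.inverse S.ν

theorem ν_mul_νInv : S.ν * S.νInv = 1 := Ring.mul_inverse_cancel _ S.isUnit_ν

theorem νInv_mul_ν : S.νInv * S.ν = 1 := Ring.inverse_mul_cancel _ S.isUnit_ν

/-- `R₂₁ R = (ν⁻¹ ⊗ ν⁻¹) Δ(ν)`. -/
theorem monodromyElement_eq : S.monodromyElement =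
    (S.νInv ⊗ₜ[k] S.νInv) * comul (R := k) S.ν := by
  rw [comul_ν, ← mul_assoc, Algebra.TensorProduct.tmul_mul_tmul, νInv_mul_ν,
    ← Algebra.TensorProduct.one_def, one_mul]

/-- `(R₂₁ R)⁻¹ = (ν ⊗ ν) Δ(ν⁻¹)`. -/
theorem monodromyElement_inv_eq : S.monodromyInv =
    (S.ν ⊗ₜ[k] S.ν) * comul (R := k) S.νInv := by
  have hc : ∀ t : H ⊗[k] H, Commute (S.ν ⊗ₜ[k] S.ν : H ⊗[k] H) t := by
    intro t
    induction t with
    | zero => exact Commute.zero_right _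
    | add s t hs ht => exact hs.add_right ht
    | tmul a b =>
      rw [Commute, SemiconjBy, Algebra.TensorProduct.tmul_mul_tmul,
        Algebra.TensorProduct.tmul_mul_tmul, (S.commute_ν a).eq, (S.commute_ν b).eq]
  refine left_inv_eq_right_inv S.monodromyInv_mul ?_
  rw [← mul_assoc, ← (hc _).eq, ← comul_ν, ← Bialgebra.comul_mul, ν_mul_νInv, Bialgebra.comul_one]

end RibbonStructure

/-! ### The finite dual -/

section FiniteDual

variable {k : Type u} {H : Type v} [Field k] [Ring H] [HopfAlgebra k H]

/-- The map `V ⊗ V^∨ → H*` sending `v ⊗ ξ` to the matrix coefficient `h ↦ ξ(h.v)`. -/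
def coefMap (V : FDMod k H) : V.carrier ⊗[k] Module.Dual k V.carrier →ₗ[k] Module.Dual k H :=
  TensorProduct.lift (LinearMap.mk₂ k (fun v ξ => ξ ∘ₗ LinearMap.applyₗ v ∘ₗ V.ρ.toLinearMap)
    (fun _ _ _ => by ext; simp) (fun _ _ _ => by ext; simp)
    (fun _ _ _ => by ext; simp) (fun _ _ _ => by ext; simp))

@[simp]
theorem coefMap_tmul (V : FDMod k H) (v : V.carrier) (ξ : Module.Dual k V.carrier) (h : H) :
    coefMap V (v ⊗ₜ ξ) h = ξ (V.ρ h v) := rfl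

variable (k H) in
/-- The finite dual `H° ⊆ H*`, spanned by the matrix coefficients of finite dimensional
modules. -/
def finiteDual : Submodule k (Module.Dual k H) := ⨆ V : FDMod k H, LinearMap.range (coefMap V)

theorem coefMap_mem_finiteDual (V : FDMod k H) (t : V.carrier ⊗[k] Module.Dual k V.carrier) :
    coefMap V t ∈ finiteDual k H :=
  le_iSup (fun V : FDMod k H => LinearMap.range (coefMap V)) V ⟨t, rfl⟩

/-- A linear condition holds on the finite dual if it holds for all matrix coefficients. -/
theorem finiteDual_le {N : Submodule k (Module.Dual k H)}
    (hN : ∀ (V : FDMod k H) (v : V.carrier) (ξ : Module.Dual k V.carrier),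
      coefMap V (v ⊗ₜ ξ) ∈ N) : finiteDual k H ≤ N := by
  refine iSup_le fun V => ?_
  rintro _ ⟨t, rfl⟩
  induction t with
  | zero => simp
  | add s t hs ht => rw [map_add]; exact N.add_mem hs ht
  | tmul v ξ => exact hN V v ξ

/-- The functional `h ↦ f(a h b)`. -/
def translate (a b : H) : Module.Dual k H →ₗ[k] Module.Dual k H :=
  Module.Dual.transpose (R := k) (LinearMap.mulLeft k a ∘ₗ LinearMap.mulRight k b)

@[simp]
theorem translate_apply (a b : H) (f : Module.Dual k H) (h : H) :
    translate a b f h = f (a * (h * b)) := rfl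

theorem translate_mem_range (V : FDMod k H) (a b : H) {f : Module.Dual k H}
    (hf : f ∈ LinearMap.range (coefMap V)) : translate a b f ∈ LinearMap.range (coefMap V) := by
  obtain ⟨t, rfl⟩ := hf
  refine ⟨TensorProduct.map (V.ρ b) (Module.Dual.transpose (R := k) (V.ρ a)) t, ?_⟩
  induction t with
  | zero => simp
  | add s t hs ht => simp only [map_add, hs, ht]
  | tmul v ξ => ext h; simp [Module.Dual.transpose_apply]

theorem translate_mem (a b : H) {f : Module.Dual k H} (hf : f ∈ finiteDual k H) :
    translate a b f ∈ finiteDual k H := by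
  have h : finiteDual k H ≤ (finiteDual k H).comap (translate a b) :=
    finiteDual_le fun V v ξ =>
      le_iSup (fun V : FDMod k H => LinearMap.range (coefMap V)) V
        (translate_mem_range V a b ⟨_, rfl⟩)
  exact h hf

/-- The dual space of a module with the action `(h.ξ)(x) = ξ(γ(h).x)`. -/
def leftDual (V : FDMod k H) : FDMod k H where
  carrier := Module.Dual k V.carrier
  ρ := AlgHom.ofLinearMap
    (Module.Dual.transpose (R := k) ∘ₗ V.ρ.toLinearMap ∘ₗ antipode k)
    (by ext ξ x; simp [Module.Dual.transpose_apply])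
    (by intro a b; ext ξ x; simp [antipode_mul_antidistrib, Module.Dual.transpose_apply])

/-- The dual space of a module with the action `(h.ξ)(x) = ξ(γ⁻¹(h).x)`. -/
def rightDual (Q : QuasitriangularStructure k H) (V : FDMod k H) : FDMod k H where
  carrier := Module.Dual k V.carrier
  ρ := Q.dualAction V.ρ

theorem comp_antipode_mem {f : Module.Dual k H} (hf : f ∈ finiteDual k H) :
    f ∘ₗ antipode k ∈ finiteDual k H := by
  have h : finiteDual k H ≤
      (finiteDual k H).comap (Module.Dual.transpose (R := k) (antipode k)) :=
    finiteDual_le fun V v ξ =>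
      coefMap_mem_finiteDual (leftDual V) (ξ ⊗ₜ Module.Dual.eval k V.carrier v)
  exact h hf

theorem comp_antipodeInv_mem (Q : QuasitriangularStructure k H) {f : Module.Dual k H}
    (hf : f ∈ finiteDual k H) : f ∘ₗ Q.antipodeInv.toLinearMap ∈ finiteDual k H := by
  have h : finiteDual k H ≤
      (finiteDual k H).comap (Module.Dual.transpose (R := k) Q.antipodeInv.toLinearMap) :=
    finiteDual_le fun V v ξ =>
      coefMap_mem_finiteDual (rightDual Q V) (ξ ⊗ₜ Module.Dual.eval k V.carrier v)
  exact h hf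

variable (k H) in
/-- The trivial module. -/
def trivialMod : FDMod k H where
  carrier := k
  ρ := (Algebra.ofId k (Module.End k k)).comp (Bialgebra.counitAlgHom k H)

theorem counit_mem : (counit (R := k) : H →ₗ[k] k) ∈ finiteDual k H := by
  convert coefMap_mem_finiteDual (trivialMod k H) ((1 : k) ⊗ₜ (LinearMap.id : k →ₗ[k] k)) using 1
  ext h
  change counit (R := k) h = algebraMap k (Module.End k k) (counit (R := k) h) 1
  simp

/-- If `H` has enough finite dimensional modules, the finite dual separates every element from
every finite dimensional subspace not containing it. -/
theorem exists_finiteDual_separating (hH : HasEnoughFDModules k H) (N : Submodule k H)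
    [FiniteDimensional k N] {h : H} (hh : h ∉ N) :
    ∃ f ∈ finiteDual k H, (∀ x ∈ N, f x = 0) ∧ f h ≠ 0 := by
  obtain ⟨φ, hφ, hφN⟩ := Submodule.exists_le_ker_of_notMem hh
  let N' := N ⊔ Submodule.span k {h}
  -- The restrictions of `H°` to `N'` separate the points of `N'`, so they are all of its dual.
  let W : Subspace k (Module.Dual k N') := (finiteDual k H).map N'.dualRestrict
  have : FiniteDimensional k N' := Submodule.finiteDimensional_sup _ _
  have : FiniteDimensional k W := FiniteDimensional.finiteDimensional_submodule W
  have hW : W.dualCoannihilator = ⊥ := by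
    rw [eq_bot_iff]
    intro x hx
    rw [Submodule.mem_dualCoannihilator] at hx
    have hx0 : (x : H) = 0 := by
      refine hH _ fun V => ?_
      ext v
      rw [LinearMap.zero_apply, ← Module.forall_dual_apply_eq_zero_iff k]
      intro ξ
      exact hx _ ⟨_, coefMap_mem_finiteDual V (v ⊗ₜ ξ), rfl⟩
    exact Subtype.ext hx0
  have hW' : W = ⊤ := by
    rw [← Subspace.dualCoannihilator_dualAnnihilator_eq (W := W), hW,
      Submodule.dualAnnihilator_bot]
  obtain ⟨f, hf, hfφ⟩ : N'.dualRestrict φ ∈ W := hW' ▸ Submodule.mem_top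
  have hval : ∀ x ∈ N', f x = φ x := fun x hx => LinearMap.congr_fun hfφ ⟨x, hx⟩
  refine ⟨f, hf, fun x hx => ?_, ?_⟩
  · rw [hval x (Submodule.mem_sup_left hx)]
    exact hφN hx
  · rw [hval h (Submodule.mem_sup_right (Submodule.mem_span_singleton_self h))]
    exact hφ

/-- The slice map `t ↦ (f ↦ (f ⊗ 1)(t))`. -/
def slice : H ⊗[k] H →ₗ[k] Module.Dual k H →ₗ[k] H :=
  TensorProduct.lift (LinearMap.mk₂ k (fun a b => (Module.Dual.eval k H a).smulRight b)
    (fun _ _ _ => by ext; simp [add_smul]) (fun _ _ _ => by ext; simp [mul_smul])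
    (fun _ _ _ => by ext; simp) (fun _ _ _ => by ext; exact smul_comm _ _ _))

@[simp]
theorem slice_tmul (a b : H) (f : Module.Dual k H) : slice (a ⊗ₜ[k] b) f = f a • b := rfl

/-- `(f ⊗ 1)((a ⊗ b) t) = b · (f(a ·) ⊗ 1)(t)`. -/
theorem slice_mul_left (a b : H) (t : H ⊗[k] H) (f : Module.Dual k H) :
    slice ((a ⊗ₜ[k] b) * t) f = b * slice t (translate a 1 f) := by
  induction t with
  | zero => simp
  | add s t hs ht => simp only [map_add, mul_add, LinearMap.add_apply, hs, ht]
  | tmul c d => simp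

theorem slice_map_antipode (t : H ⊗[k] H) (f : Module.Dual k H) :
    slice (TensorProduct.map (antipode k) (antipode k) t) f =
      antipode k (slice t (f ∘ₗ antipode k)) := by
  induction t with
  | zero => simp
  | add s t hs ht => simp only [map_add, LinearMap.add_apply, hs, ht]
  | tmul c d => simp

end FiniteDual

/-! ### The subspace `u` as a space of slices of the monodromy element -/

namespace QuasitriangularStructure

variable {k : Type u} {H : Type v} [Field k] [Ring H] [HopfAlgebra k H]
variable (Q : QuasitriangularStructure k H)

theorem lMinus_eq_slice (V : FDMod k H) (v : V.carrier) (w : Module.Dual k V.carrier) :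
    Q.lMinus V v w =
      slice Q.monodromyElement (coefMap V (v ⊗ₜ w) ∘ₗ Q.antipodeInv.toLinearMap) := by
  rw [lMinus]
  generalize Q.monodromyElement = t
  induction t with
  | zero => simp
  | add s t hs ht => simp only [map_add, LinearMap.add_apply, hs, ht]
  | tmul a b => simp [dualAction_apply]

theorem subspaceU_eq_map : Q.subspaceU = (finiteDual k H).map (slice Q.monodromyElement) := by
  apply le_antisymm
  · rw [subspaceU, Submodule.span_le]
    rintro _ ⟨V, v, w, rfl⟩
    exact ⟨_, comp_antipodeInv_mem Q (coefMap_mem_finiteDual V _), (Q.lMinus_eq_slice V v w).symm⟩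
  · rintro _ ⟨f, hf, rfl⟩
    have h : finiteDual k H ≤ Q.subspaceU.comap (slice Q.monodromyElement ∘ₗ
        Module.Dual.transpose (R := k) Q.antipodeInv.toLinearMap) :=
      finiteDual_le fun V v ξ => Submodule.subset_span ⟨V, v, ξ, (Q.lMinus_eq_slice V v ξ).symm⟩
    have hf' : f = (f ∘ₗ antipode k) ∘ₗ Q.antipodeInv.toLinearMap := by
      ext a
      simp [Q.antipode_antipodeInv]
    rw [hf']
    exact h (comp_antipode_mem hf)

theorem slice_mem_subspaceU {f : Module.Dual k H} (hf : f ∈ finiteDual k H) :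
    slice Q.monodromyElement f ∈ Q.subspaceU := by
  rw [subspaceU_eq_map]
  exact ⟨f, hf, rfl⟩

/-- `1 ∈ u`, as the slice of the monodromy element by the counit. -/
theorem one_mem_subspaceU : (1 : H) ∈ Q.subspaceU := by
  convert Q.slice_mem_subspaceU counit_mem
  have h : ∀ t : H ⊗[k] H, slice t (counit (R := k) : H →ₗ[k] k) = TensorProduct.lid k H
      (TensorProduct.map (counit (R := k)) LinearMap.id t) := by
    intro t
    induction t with
    | zero => simp
    | add s t hs ht => simp only [map_add, LinearMap.add_apply, hs, ht]
    | tmul a b => simp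
  have hmul : ∀ s t : H ⊗[k] H, slice (s * t) (counit (R := k) : H →ₗ[k] k) =
      slice s (counit (R := k) : H →ₗ[k] k) * slice t (counit (R := k) : H →ₗ[k] k) := by
    intro s t
    induction s with
    | zero => simp
    | add s s' hs hs' => simp only [map_add, LinearMap.add_apply, add_mul, hs, hs']
    | tmul a b =>
      induction t with
      | zero => simp
      | add t t' ht ht' => simp only [map_add, LinearMap.add_apply, mul_add, ht, ht']
      | tmul c d => simp [smul_smul, mul_comm]
  have hcomm : slice (TensorProduct.comm k H H (Q.R : H ⊗[k] H)) (counit (R := k) : H →ₗ[k] k) =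
      TensorProduct.rid k H
        (TensorProduct.map LinearMap.id (counit (R := k)) (Q.R : H ⊗[k] H)) := by
    generalize (Q.R : H ⊗[k] H) = t
    induction t with
    | zero => simp
    | add s t hs ht => simp only [map_add, LinearMap.add_apply, hs, ht]
    | tmul a b => simp
  rw [monodromyElement, hmul, hcomm, Q.counit_right, h, Q.counit_left, one_mul]

/-- The coproduct of a slice of the monodromy element: all left slices of `Δ((f ⊗ 1)(R₂₁ R))` are
slices of `R₂₁ R` by combinations of translates of `f`. -/
theorem slice_comul_slice {n : ℕ} {x y : Fin n → H}
    (hR : (Q.R : H ⊗[k] H) = ∑ i, x i ⊗ₜ[k] y i) (f g : Module.Dual k H) :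
    slice (comul (R := k) (slice Q.monodromyElement f)) g =
      slice Q.monodromyElement
        (∑ b, ∑ a, g (x b * y a) • translate (y b) (x a) f) := by
  let G : H → H ⊗[k] (H ⊗[k] H) →ₗ[k] H ⊗[k] H := fun c => TensorProduct.lift
    (LinearMap.mk₂ k (fun p t => f (c * p) • t)
      (fun _ _ _ => by rw [mul_add, map_add, add_smul])
      (fun _ _ _ => by rw [mul_smul_comm, map_smul, smul_assoc])
      (fun _ _ _ => by rw [smul_add]) (fun _ _ _ => by rw [smul_comm]))
  let G' : H → (H ⊗[k] H) ⊗[k] H →ₗ[k] H ⊗[k] H := fun c => TensorProduct.lift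
    (LinearMap.mk₂ k (fun t q => f (q * c) • t)
      (fun _ _ _ => by rw [smul_add]) (fun _ _ _ => by rw [smul_comm])
      (fun _ _ _ => by rw [add_mul, map_add, add_smul])
      (fun _ _ _ => by rw [smul_mul_assoc, map_smul, smul_assoc]))
  have h1 := fun c => congrArg (G c) (Q.comul_right_sum hR)
  have h2 := fun c => congrArg (G' c) (Q.comul_left_sum hR)
  simp only [G, G', map_sum, TensorProduct.lift.tmul, LinearMap.mk₂_apply] at h1 h2
  have hL : comul (R := k) (slice Q.monodromyElement f) =
      ∑ b, comul (R := k) (x b) * ∑ a, f (y b * x a) • comul (R := k) (y a) := by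
    rw [Q.monodromyElement_sum hR]
    simp [Finset.mul_sum, Bialgebra.comul_mul]
  have hL2 : comul (R := k) (slice Q.monodromyElement f) =
      ∑ p, ∑ q, (∑ b, f (y b * (x p * x q)) • comul (R := k) (x b)) * (y q ⊗ₜ[k] y p) := by
    rw [hL]
    simp only [h1, Finset.mul_sum, Finset.sum_mul, mul_smul_comm, smul_mul_assoc]
    rw [Finset.sum_comm]
    exact Finset.sum_congr rfl fun p _ => Finset.sum_comm
  rw [hL2, Q.monodromyElement_sum hR]
  simp only [h2, Finset.sum_mul, map_sum, LinearMap.sum_apply, smul_mul_assoc,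
    Algebra.TensorProduct.tmul_mul_tmul, map_smul, LinearMap.smul_apply, slice_tmul,
    translate_apply, smul_smul]
  rw [Finset.sum_congr rfl fun p _ => Finset.sum_comm, Finset.sum_comm]
  refine Finset.sum_congr rfl fun b _ => ?_
  rw [Finset.sum_comm]
  refine Finset.sum_congr rfl fun q _ => ?_
  rw [Finset.sum_comm, Finset.smul_sum]
  refine Finset.sum_congr rfl fun d _ => ?_
  rw [Finset.smul_sum]
  refine Finset.sum_congr rfl fun p _ => ?_
  rw [smul_smul, mul_comm (g _)]
  simp only [mul_assoc]

/-- For `z ∈ u`, the left slices of `Δ(z)` lie in a finite dimensional subspace of `u`. -/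
theorem exists_finite_slice_comul {z : H} (hz : z ∈ Q.subspaceU) :
    ∃ W : Submodule k H, W ≤ Q.subspaceU ∧ FiniteDimensional k W ∧
      ∀ g : Module.Dual k H, slice (comul (R := k) z) g ∈ W := by
  rw [subspaceU_eq_map] at hz
  obtain ⟨f, hf, rfl⟩ := hz
  induction hf using Submodule.iSup_induction' with
  | mem V f hf =>
    obtain ⟨n, x, y, hR⟩ := TensorProduct.exists_sum_tmul_eq (Q.R : H ⊗[k] H)
    refine ⟨(LinearMap.range (coefMap V)).map (slice Q.monodromyElement), ?_, inferInstance,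
      fun g => ?_⟩
    · rw [subspaceU_eq_map]
      exact Submodule.map_mono (le_iSup (fun V : FDMod k H => LinearMap.range (coefMap V)) V)
    · rw [Q.slice_comul_slice hR]
      exact Submodule.mem_map_of_mem (Submodule.sum_mem _ fun b _ => Submodule.sum_mem _ fun a _ =>
        Submodule.smul_mem _ _ (translate_mem_range V _ _ hf))
  | zero => exact ⟨⊥, bot_le, inferInstance, fun g => by simp⟩
  | add f f' _ _ h h' =>
    obtain ⟨W, hW, _, hg⟩ := h
    obtain ⟨W', hW', _, hg'⟩ := h'
    refine ⟨W ⊔ W', sup_le hW hW', inferInstance, fun g => ?_⟩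
    simp only [map_add, LinearMap.add_apply]
    exact Submodule.add_mem_sup (hg g) (hg' g)

/-- If `X = (z' ⊗ z') Δ(z)` with `z ∈ u` and every element of `u` is a left slice of `X`, then `u`
is finite dimensional and is contained in `z' u`. -/
theorem finite_of_slice_comul {X : H ⊗[k] H} {z z' : H} (hX : X = (z' ⊗ₜ[k] z') * comul (R := k) z)
    (hz : z ∈ Q.subspaceU)
    (hu : ∀ f ∈ finiteDual k H, ∃ f' : Module.Dual k H, slice Q.monodromyElement f = slice X f') :
    FiniteDimensional k Q.subspaceU ∧ ∀ h ∈ Q.subspaceU, ∃ h' ∈ Q.subspaceU, z' * h' = h := by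
  obtain ⟨W, hW, _, hg⟩ := Q.exists_finite_slice_comul hz
  have hle : Q.subspaceU ≤ W.map (LinearMap.mulLeft k z') := by
    rw [subspaceU_eq_map]
    rintro _ ⟨f, hf, rfl⟩
    obtain ⟨f', hf'⟩ := hu f hf
    rw [hf', hX, slice_mul_left]
    exact ⟨_, hg _, rfl⟩
  refine ⟨Submodule.finiteDimensional_of_le hle, fun h hh => ?_⟩
  obtain ⟨h', hh', rfl⟩ := hle hh
  exact ⟨h', hW hh', rfl⟩

end QuasitriangularStructure

namespace RibbonStructure

variable {k : Type u} {H : Type v} [Field k] [Ring H] [HopfAlgebra k H]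
variable (S : RibbonStructure k H)

/-- Every slice of the monodromy element by the finite dual is a slice of its inverse. In terms of
strands, the clasp of `L` and `M` becomes the opposite clasp, up to the twist of `L`, after
crossing the two ends of `L` and applying the third Reidemeister move. -/
theorem exists_slice_monodromyInv (f : Module.Dual k H) :
    ∃ f' : Module.Dual k H, slice S.monodromyElement f = slice S.monodromyInv f' := by
  obtain ⟨n, x, y, hR⟩ := TensorProduct.exists_sum_tmul_eq (S.R : H ⊗[k] H)
  have hYB := S.yang_baxter_contract hR (S.κ : H) (S.commute_contract S.κ S.conj_eq)
  rw [← ν_eq] at hYB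
  have hinv : S.monodromyInv =
      ∑ a, ∑ c, (antipode k (x a) * S.antipodeInv (y c)) ⊗ₜ[k] (y a * x c) := by
    rw [QuasitriangularStructure.monodromyInv]
    conv_lhs => enter [1]; rw [← S.antipode_left, hR]
    rw [← S.antipodeInv_right, hR]
    simp [Finset.sum_mul_sum]
  -- With `f₁ = f(ν⁻¹ ·)`, this is `f'(h) = ∑ f₁(R'' γ(h) κ R')`.
  refine ⟨(∑ b, translate (y b) ((S.κ : H) * x b) (translate S.νInv 1 f)) ∘ₗ antipode k, ?_⟩
  have h1 := congrArg (fun t => slice t (translate S.νInv 1 f)) hYB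
  have h2 : translate S.ν 1 (translate S.νInv 1 f) = f := by
    ext h
    simp [← mul_assoc, νInv_mul_ν]
  simp only [slice_mul_left, h2, one_mul] at h1
  rw [← h1, hinv]
  simp only [map_sum, LinearMap.sum_apply, slice_tmul, LinearMap.comp_apply,
    antipode_mul_antidistrib, S.antipode_antipodeInv, ← S.conj_eq, Finset.sum_smul]
  rw [Finset.sum_congr rfl fun c _ => Finset.sum_comm, Finset.sum_comm]
  refine Finset.sum_congr rfl fun a _ => Finset.sum_congr rfl fun c _ =>
    Finset.sum_congr rfl fun b _ => ?_
  have hκ : ∀ t : H, ((S.κ⁻¹ : Hˣ) : H) * ((S.κ : H) * t) = t := fun t =>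
    Units.inv_mul_cancel_left _ _
  simp only [translate_apply, mul_assoc, hκ]

end RibbonStructure

/-! ### The coend and the pairing `ω` -/

section Coend

variable {k : Type u} {H : Type v} [Field k] [Ring H] [HopfAlgebra k H]

variable (k H) in
/-- The map `F → H*` given by matrix coefficients; its image is the finite dual. -/
def coendCoef : CoendF k H →ₗ[k] Module.Dual k H :=
  coendLift coefMap fun A B f hf a ξ => by
    ext h
    simp [Module.Dual.transpose_apply, hf h a]

@[simp]
theorem coendCoef_coendMap (L : FDMod k H) (t : L.carrier ⊗[k] Module.Dual k L.carrier) :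
    coendCoef k H (coendMap L t) = coefMap L t :=
  coendLift_coendMap _ _ L t

theorem coendCoef_mem (x : CoendF k H) : coendCoef k H x ∈ finiteDual k H := by
  have h : (finiteDual k H).mkQ ∘ₗ coendCoef k H = 0 := coend_hom_ext fun L l ξ => by
    simpa using coefMap_mem_finiteDual L (l ⊗ₜ ξ)
  have h2 := LinearMap.congr_fun h x
  simpa using h2

theorem exists_coendCoef_eq {f : Module.Dual k H} (hf : f ∈ finiteDual k H) :
    ∃ x, coendCoef k H x = f := by
  have h : finiteDual k H ≤ LinearMap.range (coendCoef k H) :=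
    finiteDual_le fun V v ξ => ⟨coendMap V (v ⊗ₜ ξ), coendCoef_coendMap _ _⟩
  exact h hf

end Coend

namespace QuasitriangularStructure

variable {k : Type u} {H : Type v} [Field k] [Ring H] [HopfAlgebra k H]
variable (Q : QuasitriangularStructure k H)

/-- The map `F → H` sending `i_L(l ⊗ ξ)` to `l⁻_L(l ⊗ ξ)`. -/
def coendSlice : CoendF k H →ₗ[k] H :=
  slice Q.monodromyElement ∘ₗ
    Module.Dual.transpose (R := k) Q.antipodeInv.toLinearMap ∘ₗ coendCoef k H

theorem omega_eq (x y : CoendF k H) :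
    Q.omega x y = coendCoef k H y (Q.coendSlice x) := by
  have h : Q.omega.flip y = coendCoef k H y ∘ₗ Q.coendSlice := coend_hom_ext fun L l ξ => by
    have h' : Q.omega (coendMap L (l ⊗ₜ ξ)) =
        LinearMap.applyₗ (Q.coendSlice (coendMap L (l ⊗ₜ ξ))) ∘ₗ coendCoef k H :=
      coend_hom_ext fun M m η => by
        rw [omega_coendMap, omegaPair_apply, lMinus_eq_slice]
        simp only [LinearMap.comp_apply, LinearMap.applyₗ_apply_apply, coendCoef_coendMap,
          coefMap_tmul, coendSlice]
        rfl
    exact LinearMap.congr_fun h' y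
  exact LinearMap.congr_fun h x

theorem omega_eq_right (x y : CoendF k H) :
    Q.omega x y = coendCoef k H x (Q.antipodeInv
      (slice (TensorProduct.comm k H H Q.monodromyElement) (coendCoef k H y))) := by
  rw [omega_eq, coendSlice, LinearMap.comp_apply, LinearMap.comp_apply]
  generalize Q.monodromyElement = t
  generalize coendCoef k H x = f
  generalize coendCoef k H y = g
  induction t with
  | zero => simp
  | add s t hs ht => simp only [map_add, LinearMap.add_apply, hs, ht]
  | tmul a b => simp [Module.Dual.transpose_apply, mul_comm]

/-- The elements `l⁺(y)` with `ω(x, y) = ⟨x, l⁺(y)⟩` also run over `u`, because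
`(γ ⊗ γ)(R₂₁ R) = R R₂₁`. -/
theorem antipodeInv_slice_comm (f : Module.Dual k H) :
    Q.antipodeInv (slice (TensorProduct.comm k H H Q.monodromyElement) f) =
      slice Q.monodromyElement (f ∘ₗ antipode k) := by
  rw [← antipode_monodromyElement, slice_map_antipode, antipodeInv_antipode]

/-- `Ann ω` consists of the `x ∈ F` whose matrix coefficient vanishes on `u`. -/
theorem mem_annOmega_iff (x : CoendF k H) :
    x ∈ Q.annOmega ↔ ∀ h ∈ Q.subspaceU, coendCoef k H x h = 0 := by
  rw [annOmega, LinearMap.mem_ker]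
  constructor
  · intro hx h hh
    rw [subspaceU_eq_map] at hh
    obtain ⟨f, hf, rfl⟩ := hh
    obtain ⟨y, hy⟩ := exists_coendCoef_eq (comp_antipodeInv_mem Q hf)
    have h1 := Q.omega_eq_right x y
    rw [hx, antipodeInv_slice_comm, hy, LinearMap.zero_apply] at h1
    rw [h1]
    congr 2
    ext a
    simp [antipodeInv_antipode]
  · intro hx
    refine LinearMap.ext fun y => ?_
    rw [omega_eq_right, antipodeInv_slice_comm]
    exact hx _ (Q.slice_mem_subspaceU (comp_antipode_mem (coendCoef_mem y)))

/-- The image of `F` in `H` is `u`. -/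
theorem range_coendSlice : LinearMap.range Q.coendSlice = Q.subspaceU := by
  rw [subspaceU_eq_map]
  apply le_antisymm
  · rintro _ ⟨x, rfl⟩
    exact ⟨_, comp_antipodeInv_mem Q (coendCoef_mem x), rfl⟩
  · rintro _ ⟨f, hf, rfl⟩
    obtain ⟨x, hx⟩ := exists_coendCoef_eq (comp_antipode_mem hf)
    refine ⟨x, ?_⟩
    rw [coendSlice, LinearMap.comp_apply, LinearMap.comp_apply, hx]
    congr 1
    ext a
    simp [Module.Dual.transpose_apply, Q.antipode_antipodeInv]

theorem ker_coendSlice (hH : HasEnoughFDModules k H) :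
    LinearMap.ker Q.coendSlice = Q.annOmega := by
  ext x
  rw [annOmega, LinearMap.mem_ker, LinearMap.mem_ker]
  constructor
  · intro hx
    refine LinearMap.ext fun y => ?_
    rw [omega_eq, hx, map_zero, LinearMap.zero_apply]
  · intro hx
    refine hH _ fun V => ?_
    ext v
    rw [LinearMap.zero_apply, ← Module.forall_dual_apply_eq_zero_iff k]
    intro ξ
    have h := Q.omega_eq x (coendMap V (v ⊗ₜ ξ))
    rw [hx, coendCoef_coendMap, coefMap_tmul, LinearMap.zero_apply] at h
    exact h.symm

/-- Under the pairing of `F` with `H`, the action of `h` on `F` is adjoint to the operator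
`z ↦ ∑ γ(h₁) z h₂`, up to `γ⁻¹`. -/
theorem coendCoef_coendAction (h z : H) (x : CoendF k H) :
    coendCoef k H (Q.coendAction h x) (Q.antipodeInv z) =
      ∑ i ∈ (ℛ k h).index, coendCoef k H x
        (Q.antipodeInv (antipode k ((ℛ k h).left i) * z * (ℛ k h).right i)) := by
  have key : LinearMap.applyₗ (Q.antipodeInv z) ∘ₗ coendCoef k H ∘ₗ Q.coendAction h =
      ∑ i ∈ (ℛ k h).index, LinearMap.applyₗ
        (Q.antipodeInv (antipode k ((ℛ k h).left i) * z * (ℛ k h).right i)) ∘ₗ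
          coendCoef k H := coend_hom_ext fun L l ξ => by
    simp only [LinearMap.comp_apply, LinearMap.sum_apply, ← Q.coendMap_isHom L h _,
      coendCoef_coendMap, LinearMap.applyₗ_apply_apply, coefMap_tmul, pairAction, tensorAction,
      AlgHom.comp_apply, Bialgebra.comulAlgHom_apply]
    conv_lhs => rw [← (ℛ k h).eq]
    simp only [map_sum, LinearMap.sum_apply, actTwo_tmul, coefMap_tmul, dualAction_apply,
      antipodeInv_mul, antipodeInv_antipode, map_mul, Module.End.mul_apply]
  simpa using LinearMap.congr_fun key x

/-- The annihilator of `ω` is an `H`-submodule of `F`. -/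
theorem coendAction_mem_annOmega (h : H) {x : CoendF k H} (hx : x ∈ Q.annOmega) :
    Q.coendAction h x ∈ Q.annOmega := by
  -- `∑ (γ(h₁) ⊗ 1) M (h₂ ⊗ 1) = ∑ (1 ⊗ h₁) M (1 ⊗ γ(h₂))`, so that the operator adjoint to the
  -- action of `h` takes slices of `M` by `H°` to slices of `M` by `H°`.
  have hshift := convMul_antipode_shift (k := k) (H := H) (A := H ⊗[k] H)
    Algebra.TensorProduct.includeLeft Algebra.TensorProduct.includeRight
    (LinearMap.mulLeft k Q.monodromyElement ∘ₗ
      (Algebra.TensorProduct.includeLeft : H →ₐ[k] H ⊗[k] H).toLinearMap)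
    (LinearMap.mulRight k Q.monodromyElement ∘ₗ
      (Algebra.TensorProduct.includeRight : H →ₐ[k] H ⊗[k] H).toLinearMap) (by
      ext a
      have h1 := (Q.commute_monodromyElement a).eq
      simp only [(ℛ k a).convMul_apply]
      rw [← (ℛ k a).eq] at h1
      simpa [Finset.sum_mul, Finset.mul_sum, mul_assoc, ← mul_assoc _ _ Q.monodromyElement]
        using h1)
  have hshift' := congrArg (fun f => TensorProduct.comm k H H (f.ofConv h)) hshift
  simp only [(ℛ k h).convMul_apply, LinearMap.comp_apply, AlgHom.toLinearMap_apply,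
    Algebra.TensorProduct.includeLeft_apply, Algebra.TensorProduct.includeRight_apply,
    LinearMap.mulLeft_apply, LinearMap.mulRight_apply, map_sum, comm_mul,
    TensorProduct.comm_tmul] at hshift'
  have hsl : ∀ (t : H ⊗[k] H) (a b : H) (f : Module.Dual k H),
      a * slice t f * b = slice ((1 ⊗ₜ[k] a) * (t * (1 ⊗ₜ[k] b))) f := by
    intro t a b f
    induction t with
    | zero => simp
    | add s t hs ht => simp only [map_add, mul_add, add_mul, LinearMap.add_apply, hs, ht]
    | tmul c d => simp [mul_assoc]
  have hsl' : ∀ (t : H ⊗[k] H) (a b : H) (f : Module.Dual k H),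
      slice ((a ⊗ₜ[k] 1) * t * (b ⊗ₜ[k] 1)) f = slice t (translate a b f) := by
    intro t a b f
    induction t with
    | zero => simp
    | add s t hs ht => simp only [map_add, mul_add, add_mul, LinearMap.add_apply, hs, ht]
    | tmul c d => simp [mul_assoc]
  rw [annOmega, LinearMap.mem_ker]
  refine LinearMap.ext fun y => ?_
  obtain ⟨y', hy'⟩ := exists_coendCoef_eq (k := k) (H := H) (Submodule.sum_mem _
    fun i (_ : i ∈ (ℛ k h).index) => translate_mem ((ℛ k h).left i) (antipode k ((ℛ k h).right i))
      (coendCoef_mem y))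
  have hy := Q.omega_eq_right x y'
  rw [annOmega, LinearMap.mem_ker] at hx
  rw [hx, LinearMap.zero_apply, hy', map_sum] at hy
  rw [omega_eq_right, coendCoef_coendAction, LinearMap.zero_apply, hy]
  simp only [← map_sum]
  congr 2
  simp only [hsl, ← hsl', map_sum]
  simpa only [map_sum, LinearMap.sum_apply] using
    congrArg (fun t => slice t (coendCoef k H y)) hshift'

/-- Axiom (M1) says that `u ≅ F / Ann ω` is finite dimensional. -/
theorem axiomM1_iff (hH : HasEnoughFDModules k H) :
    Q.AxiomM1 ↔ FiniteDimensional k Q.subspaceU := by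
  constructor
  · rintro ⟨V, π, -, hπ, hker⟩
    have e := (Submodule.quotEquivOfEq _ _ (hker.trans (Q.ker_coendSlice hH).symm)).symm.trans
      (LinearMap.quotKerEquivOfSurjective π hπ)
    rw [← range_coendSlice]
    exact (Q.coendSlice.quotKerEquivRange.symm.trans e).symm.finiteDimensional
  · intro hfin
    have hq : FiniteDimensional k (CoendF k H ⧸ Q.annOmega) := by
      rw [← range_coendSlice] at hfin
      rw [← Q.ker_coendSlice hH]
      exact Q.coendSlice.quotKerEquivRange.symm.finiteDimensional
    -- The quotient `F / Ann ω` may live in another universe than the objects of `H`-mod, so the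
    -- action is carried over to `kⁿ`.
    let e := (Module.finBasis k (CoendF k H ⧸ Q.annOmega)).equivFun
    let ρ : H →ₐ[k] Module.End k (CoendF k H ⧸ Q.annOmega) := AlgHom.ofLinearMap
      { toFun := fun h => Q.annOmega.mapQ Q.annOmega (Q.coendAction h)
          fun _ hx => Q.coendAction_mem_annOmega h hx
        map_add' := fun a b => Submodule.linearMap_qext _ (by ext; simp)
        map_smul' := fun c a => Submodule.linearMap_qext _ (by ext; simp) }
      (Submodule.linearMap_qext _ (by ext; simp))
      (fun a b => Submodule.linearMap_qext _ (by ext; simp))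
    refine ⟨⟨_, (LinearEquiv.conjAlgEquiv k e).toAlgHom.comp ρ⟩, e.toLinearMap ∘ₗ Q.annOmega.mkQ,
      fun h x => ?_, e.surjective.comp (Submodule.mkQ_surjective _), ?_⟩
    · simp [ρ, LinearEquiv.conjAlgEquiv]
    · rw [LinearEquiv.ker_comp, Submodule.ker_mkQ]

end QuasitriangularStructure

/-! ### Modularity in terms of the subspace `u` -/

namespace RibbonStructure

variable {k : Type u} {H : Type v} [Field k] [Ring H] [HopfAlgebra k H]
variable (S : RibbonStructure k H)

theorem coendCoef_twistF (x : CoendF k H) (h : H) :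
    coendCoef k H (S.twistF x) h = coendCoef k H x (h * S.ν) := by
  have key : LinearMap.applyₗ h ∘ₗ coendCoef k H ∘ₗ S.twistF =
      LinearMap.applyₗ (h * S.ν) ∘ₗ coendCoef k H := coend_hom_ext fun L l ξ => by
    simp [twistF, coendLift_coendMap]
  exact LinearMap.congr_fun key x

/-- If `u` is finite dimensional, axiom (M2) says that `u` is stable under multiplication
by `ν`. -/
theorem axiomM2_iff (hH : HasEnoughFDModules k H) [FiniteDimensional k S.subspaceU] :
    S.AxiomM2 ↔ ∀ h ∈ S.subspaceU, S.ν * h ∈ S.subspaceU := by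
  simp only [AxiomM2, QuasitriangularStructure.mem_annOmega_iff, coendCoef_twistF,
    (S.commute_ν _).eq]
  constructor
  · intro hM h hh
    by_contra hn
    obtain ⟨f, hf, hf0, hf1⟩ := exists_finiteDual_separating hH S.subspaceU hn
    obtain ⟨x, rfl⟩ := exists_coendCoef_eq hf
    exact hf1 (hM x hf0 h hh)
  · intro hu x hx h hh
    exact hx _ (hu h hh)

theorem isTwoModular_iff (hH : HasEnoughFDModules k H) :
    S.IsTwoModular ↔ FiniteDimensional k S.subspaceU ∧
      ∀ h ∈ S.subspaceU, S.ν * h ∈ S.subspaceU := by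
  rw [IsTwoModular, S.axiomM1_iff hH]
  exact and_congr_right fun _ => S.axiomM2_iff hH

end RibbonStructure

/-- If left multiplication by an invertible `z` maps a finite dimensional subspace into itself, it
maps it onto itself. -/
theorem exists_mul_eq_of_finite {k : Type u} {H : Type v} [Field k] [Ring H] [Algebra k H]
    {N : Submodule k H} [FiniteDimensional k N] {z z' : H} (hz : z' * z = 1)
    (hN : ∀ h ∈ N, z * h ∈ N) {h : H} (hh : h ∈ N) : ∃ h' ∈ N, z * h' = h := by
  let f : N →ₗ[k] N := (LinearMap.mulLeft k z).restrict hN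
  have hf : Function.Injective f := by
    intro a b hab
    have h1 : z * (a : H) = z * b := congrArg Subtype.val hab
    apply Subtype.ext
    rw [← one_mul (a : H), ← one_mul (b : H), ← hz, mul_assoc, mul_assoc, h1]
  obtain ⟨a, ha⟩ := LinearMap.surjective_of_injective hf ⟨h, hh⟩
  exact ⟨a, a.2, congrArg Subtype.val ha⟩

namespace RibbonStructure

variable {k : Type u} {H : Type v} [Field k] [Ring H] [HopfAlgebra k H]
variable (S : RibbonStructure k H)

theorem isTwoModular_iff_ν_mem (hH : HasEnoughFDModules k H) :
    S.IsTwoModular ↔ S.ν ∈ S.subspaceU := by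
  rw [S.isTwoModular_iff hH]
  constructor
  · rintro ⟨-, h⟩
    simpa using h 1 S.one_mem_subspaceU
  · intro hν
    obtain ⟨hfin, h⟩ := S.finite_of_slice_comul S.monodromyElement_eq hν fun f _ => ⟨f, rfl⟩
    refine ⟨hfin, fun a ha => ?_⟩
    obtain ⟨a', ha', rfl⟩ := h a ha
    rwa [← mul_assoc, ν_mul_νInv, one_mul]

theorem isTwoModular_iff_νInv_mem (hH : HasEnoughFDModules k H) :
    S.IsTwoModular ↔ S.νInv ∈ S.subspaceU := by
  rw [S.isTwoModular_iff hH]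
  constructor
  · rintro ⟨_, h⟩
    obtain ⟨a, ha, h1⟩ := exists_mul_eq_of_finite S.νInv_mul_ν h S.one_mem_subspaceU
    rwa [← left_inv_eq_right_inv S.νInv_mul_ν h1] at ha
  · intro hν
    obtain ⟨hfin, h⟩ := S.finite_of_slice_comul S.monodromyElement_inv_eq hν
      fun f _ => S.exists_slice_monodromyInv f
    refine ⟨hfin, ?_⟩
    have hstep : ∀ a ∈ S.subspaceU, S.νInv * a ∈ S.subspaceU := by
      intro a ha
      obtain ⟨a', ha', rfl⟩ := h a ha
      rwa [← mul_assoc, νInv_mul_ν, one_mul]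
    intro a ha
    obtain ⟨a', ha', rfl⟩ := exists_mul_eq_of_finite S.ν_mul_νInv hstep ha
    rwa [← mul_assoc, ν_mul_νInv, one_mul]

end RibbonStructure

end RibbonHopf

end

theorem mainTheorem6 {k : Type u} [Field k] {H : Type v} [Ring H] [HopfAlgebra k H]
    (S : RibbonHopf.RibbonStructure k H) (hH : RibbonHopf.HasEnoughFDModules k H) :
    (S.IsTwoModular ↔ S.ν ∈ S.subspaceU) ∧
      IsUnit S.ν ∧ (S.IsTwoModular ↔ Ring.inverse S.ν ∈ S.subspaceU) :=
  ⟨S.isTwoModular_iff_ν_mem hH, S.isUnit_ν, S.isTwoModular_iff_νInv_mem hH⟩
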